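/- For an $r\times n$ real matrix $M'$ and $\delta>0$, say that $M'$ is \emph{$\delta$-non-degenerate} if for every unit vector $e\in\mathbb{R}^r$ (in the Euclidean norm) there are at least $\delta n$ columns $w$ of $M'$ (counted with multiplicity) satisfying $|\langle w,e\rangle|\ge\delta$. For every integer $r\ge 3$ and every $\delta>0$ there is a constant $C=C(r,\delta)>0$ such that the following holds. Let $n\ge 1$ and consider a real quadratic polynomial \[ f(x)=\sum_{1\le i\le j\le n}a_{ij}x_ix_j+\sum_{1\le i\le n}a_ix_i+a_0, \] let $a_{ji}=a_{ij}$ for $i<j$, and let $M=(a_{ij})_{i,j}\in\mathbb{R}^{n\times n}$. Suppose that $|a_{ij}|\le 1$ for all $i,j\in\{1,\dots,n\}$, and suppose that there is a set $T\subseteq\{1,\dots,n\}^r$ of at least $\delta n$ $r$-tuples, no two of which share an index, such that for each $(i_1,\dots,i_r)\in T$ the $r\times n$ matrix whose rows are the rows $i_1,\dots,i_r$ of $M$ is $\delta$-non-degenerate. Let $\xi=(\xi_1,\dots,\xi_n)$ be a sequence of independent Rademacher random variables, i.e. $\Pr(\xi_i=1)=\Pr(\xi_i=-1)=1/2$. Then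 for every $x\in\mathbb{R}$, \[ \Pr\left(|f(\xi)-x|\le n^{2/(r+2)}\right)\le C\cdot\frac{(\log n)^{r/2}}{n^{1-2/(r+2)}}, \] where $\log$ is the natural logarithm. -/

import Mathlib

open MeasureTheory ProbabilityTheory
open scoped ENNReal

/-- The Rademacher distribution: the values `1` and `-1` have probability `1/2` each. -/
noncomputable def rademacher : Measure ℝ :=
  (1 / 2 : ℝ≥0∞) • Measure.dirac 1 + (1 / 2 : ℝ≥0∞) • Measure.dirac (-1)

/-- `ξ = (ξ₁, …, ξₙ)` is a sequence of independent Rademacher random variables. -/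
structure IsRademacherVector {Ω : Type*} [MeasurableSpace Ω] {n : ℕ}
    (ξ : Fin n → Ω → ℝ) (μ : Measure Ω) : Prop where
  hasLaw : ∀ i, HasLaw (ξ i) rademacher μ
  indep : iIndepFun ξ μ

/-- The value at `x` of the polynomial
`∑_{i ≤ j} a i j * x i * x j + ∑ i, b i * x i + c`.
Only the entries `a i j` with `i ≤ j` are used. -/
def quadraticPoly {n : ℕ} (a : Fin n → Fin n → ℝ) (b : Fin n → ℝ) (c : ℝ)
    (x : Fin n → ℝ) : ℝ :=
  (∑ i, ∑ j ∈ Finset.Ici i, a i j * x i * x j) + (∑ i, b i * x i) + c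

/-- The symmetric matrix whose `(i, j)` entry is `a i j` for `i ≤ j` and `a j i` for `i > j`. -/
def coeffMatrix {n : ℕ} (a : Fin n → Fin n → ℝ) : Matrix (Fin n) (Fin n) ℝ :=
  Matrix.of fun i j => if i ≤ j then a i j else a j i

/-- An `r × n` matrix is `δ`-non-degenerate if for every (Euclidean) unit vector `e ∈ ℝʳ` there
are at least `δ n` columns `w` with `|⟨w, e⟩| ≥ δ` (columns are counted by their index). -/
def IsNonDegenerate {r n : ℕ} (δ : ℝ) (M : Matrix (Fin r) (Fin n) ℝ) : Prop :=
  ∀ e : EuclideanSpace ℝ (Fin r), ‖e‖ = 1 →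
    δ * n ≤ ((Finset.univ.filter fun j : Fin n =>
      δ ≤ |inner ℝ (WithLp.toLp 2 (M.col j)) e|).card : ℝ)

/-! The proof is Fourier-analytic. The proportion of sign vectors with f within s = n^(2/(r+2)) of x
is at most a constant times the mean of |φ(τ)| over 0 ≤ τ ≤ 1/s, where φ is the characteristic
function of f(ξ) (`card_abs_sub_le_le_integral`).

The core is |φ(τ)|² ≤ (C(1/(nτ) + τ))^r (`exists_norm_sq_sum_cexp_le`). Take 2h tuples of T, with h
of order n, using at most δn/2 indices. Cauchy–Schwarz in the variables at these indices decouples f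
and leaves a product of cosines of linear forms in y - y', where y, y' are two copies of the other
signs. AM–GM over the tuples reduces this to the mean of ∏ₖ cos^(2h) for one tuple. Expanding the
powers gives a sum over V ∈ ℤ^r of binomial weights times ∏ⱼ cos²(2τ⟨V, wⱼ⟩). In a box of side about
1/τ, non-degeneracy bounds these products by a Gaussian of width of order 1/(τ√n), so a box
contributes O((1 + 1/(τ√n))^r). The largest weights of the boxes sum to O((1/√n + τ)^r).

Put R = n/s, so that s^r = R². For r ≥ 3 this gives |φ(w/s)| = O(1/R + (1 + wR)^(-3/2)), with
integral O(1/R) over [0,1]. No logarithm is lost: (log n)^(r/2) matters only through being at least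
1. -/

/-! ### Smoothing inequality. -/

/-- The squared modulus of the Fourier transform of the indicator of [0,1] is a non-negative
function with frequencies in [-1,1] that is bounded below near 0. It serves as a majorant of an
interval. -/
lemma quarter_le_norm_sq_integral_cexp {y : ℝ} (hy : |y| ≤ 1) :
    (1 / 4 : ℝ) ≤ ‖∫ u in (0 : ℝ)..1, Complex.exp ((u * y : ℝ) * Complex.I)‖ ^ 2 := by
  have hre : (1 / 2 : ℝ) ≤ (∫ u in (0 : ℝ)..1, Complex.exp ((u * y : ℝ) * Complex.I)).re := by
    have hint : IntervalIntegrable (fun u : ℝ => Complex.exp ((u * y : ℝ) * Complex.I))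
        volume 0 1 := Continuous.intervalIntegrable (by fun_prop) _ _
    have h1 : (∫ u in (0 : ℝ)..1, Complex.exp ((u * y : ℝ) * Complex.I)).re
        = ∫ u in (0 : ℝ)..1, Real.cos (u * y) := by
      have := Complex.reCLM.intervalIntegral_comp_comm hint
      simp only [Complex.reCLM_apply] at this
      rw [← this]
      congr 1
      ext u
      rw [Complex.exp_ofReal_mul_I_re]
    rw [h1]
    have h2 : ∫ _u in (0 : ℝ)..1, (1 / 2 : ℝ) ≤ ∫ u in (0 : ℝ)..1, Real.cos (u * y) := by
      apply intervalIntegral.integral_mono_on zero_le_one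
      · exact intervalIntegrable_const
      · exact Continuous.intervalIntegrable (by fun_prop) _ _
      · intro u hu
        have h3 : (u * y) ^ 2 ≤ 1 := by
          have : |u * y| ≤ 1 := by
            rw [abs_mul, abs_of_nonneg hu.1]
            nlinarith [hu.2, hu.1, abs_nonneg y]
          rw [← sq_abs]
          nlinarith [abs_nonneg (u * y)]
        have := Real.one_sub_sq_div_two_le_cos (x := u * y)
        linarith
    simpa using h2
  have h := Complex.abs_re_le_norm (∫ u in (0 : ℝ)..1, Complex.exp ((u * y : ℝ) * Complex.I))
  have h' := le_trans hre ((le_abs_self _).trans h)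
  nlinarith

lemma integral_sub_le_integral {F : ℝ → ℝ} (hF : Continuous F) (h0 : ∀ x, 0 ≤ F x) {u : ℝ}
    (hu : u ∈ Set.Icc (0 : ℝ) 1) :
    ∫ v in (0 : ℝ)..1, F (u - v) ≤ ∫ w in (-1 : ℝ)..1, F w := by
  rw [intervalIntegral.integral_comp_sub_left (fun x => F x) u]
  apply intervalIntegral.integral_mono_interval
  · linarith [hu.1]
  · linarith
  · linarith [hu.2]
  · exact Filter.Eventually.of_forall fun x => h0 x
  · exact hF.intervalIntegrable _ _

/-- A smoothing inequality for finitely many real numbers: the number of them in an interval of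
length `2 s` is controlled by the exponential sums of frequency at most `1 / s`. -/
lemma card_abs_sub_le_le_integral {ι : Type*} [Fintype ι] (X : ι → ℝ) (x : ℝ) {s : ℝ}
    (hs : 0 < s) :
    ((Finset.univ.filter fun i => |X i - x| ≤ s).card : ℝ)
      ≤ 8 * ∫ w in (0 : ℝ)..1, ‖∑ i, Complex.exp ((w / s * X i : ℝ) * Complex.I)‖ := by
  set F : ℝ → ℝ := fun w => ‖∑ i, Complex.exp ((w / s * X i : ℝ) * Complex.I)‖ with hFdef
  have hF : Continuous F := by fun_prop
  set y : ι → ℝ := fun i => (X i - x) / s with hy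
  set k : ι → ℂ := fun i => ∫ u in (0 : ℝ)..1, Complex.exp ((u * y i : ℝ) * Complex.I) with hk
  have hcard : ((Finset.univ.filter fun i => |X i - x| ≤ s).card : ℝ)
      ≤ 4 * ∑ i, ‖k i‖ ^ 2 := by
    calc ((Finset.univ.filter fun i => |X i - x| ≤ s).card : ℝ)
        = ∑ i ∈ Finset.univ.filter fun i => |X i - x| ≤ s, (1 : ℝ) := by simp
      _ ≤ ∑ i ∈ Finset.univ.filter fun i => |X i - x| ≤ s, 4 * ‖k i‖ ^ 2 := by
        apply Finset.sum_le_sum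
        intro i hi
        have hi' : |X i - x| ≤ s := by simpa using hi
        have := quarter_le_norm_sq_integral_cexp (y := y i) (by
          rw [hy]; simp only [abs_div, abs_of_pos hs]; exact (div_le_one hs).2 hi')
        simp only [hk]
        linarith
      _ ≤ ∑ i, 4 * ‖k i‖ ^ 2 :=
        Finset.sum_le_sum_of_subset_of_nonneg (Finset.filter_subset _ _)
          (fun _ _ _ => by positivity)
      _ = 4 * ∑ i, ‖k i‖ ^ 2 := by rw [Finset.mul_sum]
  -- As a double integral, the majorant involves only the frequencies u - v ∈ [-1,1].
  have hsq : ∀ i, ((‖k i‖ ^ 2 : ℝ) : ℂ) = ∫ u in (0 : ℝ)..1, ∫ v in (0 : ℝ)..1,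
      Complex.exp (((u - v) * y i : ℝ) * Complex.I) := by
    intro i
    have h1 : ((‖k i‖ ^ 2 : ℝ) : ℂ) = k i * (starRingEnd ℂ) (k i) := by
      rw [Complex.mul_conj, Complex.normSq_eq_norm_sq]
    have h2 : (starRingEnd ℂ) (k i)
        = ∫ v in (0 : ℝ)..1, Complex.exp ((-v * y i : ℝ) * Complex.I) := by
      simp only [hk]
      rw [← intervalIntegral.intervalIntegral_conj]
      congr 1
      ext v
      rw [← Complex.exp_conj]
      simp
    rw [h1, h2]
    simp only [hk]
    rw [← intervalIntegral.integral_mul_const]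
    congr 1
    ext u
    rw [← intervalIntegral.integral_const_mul]
    congr 1
    ext v
    rw [← Complex.exp_add]
    congr 1
    push_cast
    ring
  have hsum : ((∑ i, ‖k i‖ ^ 2 : ℝ) : ℂ) = ∫ u in (0 : ℝ)..1, ∫ v in (0 : ℝ)..1,
      ∑ i, Complex.exp (((u - v) * y i : ℝ) * Complex.I) := by
    rw [Complex.ofReal_sum, Finset.sum_congr rfl fun i _ => hsq i]
    rw [← intervalIntegral.integral_finsetSum]
    · congr 1
      ext u
      rw [← intervalIntegral.integral_finsetSum]
      intro i _
      exact Continuous.intervalIntegrable (by fun_prop) _ _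
    · intro i _
      apply Continuous.intervalIntegrable
      apply intervalIntegral.continuous_parametric_intervalIntegral_of_continuous'
      fun_prop
  -- The centre x enters only through a unimodular factor, so the bound is uniform in x.
  have hnorm : ∀ u v : ℝ, ‖∑ i, Complex.exp (((u - v) * y i : ℝ) * Complex.I)‖ = F (u - v) := by
    intro u v
    have : ∑ i, Complex.exp (((u - v) * y i : ℝ) * Complex.I)
        = Complex.exp ((-(u - v) * x / s : ℝ) * Complex.I)
          * ∑ i, Complex.exp (((u - v) / s * X i : ℝ) * Complex.I) := by
      rw [Finset.mul_sum]
      apply Finset.sum_congr rfl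
      intro i _
      rw [← Complex.exp_add, ← add_mul, ← Complex.ofReal_add]
      congr 3
      simp only [hy]
      ring
    rw [this, norm_mul, Complex.norm_exp_ofReal_mul_I, one_mul]
  have hle : ∑ i, ‖k i‖ ^ 2 ≤ ∫ w in (-1 : ℝ)..1, F w := by
    have h0 : (0 : ℝ) ≤ ∑ i, ‖k i‖ ^ 2 := Finset.sum_nonneg fun _ _ => by positivity
    have h1 : ∑ i, ‖k i‖ ^ 2 = ‖((∑ i, ‖k i‖ ^ 2 : ℝ) : ℂ)‖ := by
      rw [Complex.norm_real, Real.norm_of_nonneg h0]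
    rw [h1, hsum]
    calc _ ≤ ∫ u in (0 : ℝ)..1, ‖∫ v in (0 : ℝ)..1,
          ∑ i, Complex.exp (((u - v) * y i : ℝ) * Complex.I)‖ :=
          intervalIntegral.norm_integral_le_integral_norm zero_le_one
      _ ≤ ∫ _u in (0 : ℝ)..1, ∫ w in (-1 : ℝ)..1, F w := by
        apply intervalIntegral.integral_mono_on zero_le_one
        · apply Continuous.intervalIntegrable
          apply Continuous.norm
          apply intervalIntegral.continuous_parametric_intervalIntegral_of_continuous'
          fun_prop
        · exact intervalIntegrable_const
        · intro u hu
          refine (intervalIntegral.norm_integral_le_integral_norm zero_le_one).trans ?_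
          simp_rw [hnorm]
          exact integral_sub_le_integral hF (fun _ => norm_nonneg _) hu
      _ = ∫ w in (-1 : ℝ)..1, F w := by simp
  have heven : ∀ w, F (-w) = F w := by
    intro w
    simp only [hFdef]
    rw [← Complex.norm_conj, map_sum]
    congr 1
    apply Finset.sum_congr rfl
    intro i _
    rw [← Complex.exp_conj]
    congr 1
    simp
    ring
  have hsplit : ∫ w in (-1 : ℝ)..1, F w = 2 * ∫ w in (0 : ℝ)..1, F w := by
    rw [← intervalIntegral.integral_add_adjacent_intervals (b := 0)
      (hF.intervalIntegrable _ _) (hF.intervalIntegrable _ _)]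
    have : ∫ w in (-1 : ℝ)..0, F w = ∫ w in (0 : ℝ)..1, F w := by
      have h := intervalIntegral.integral_comp_neg (a := 0) (b := 1) F
      simp only [heven, neg_zero] at h
      exact h.symm
    rw [this]
    ring
  linarith

/-! ### Exponential sums over signs and decoupling. -/

/-- The sign `±1` encoded by a Boolean. -/
def boolSign (b : Bool) : ℝ := if b then 1 else -1

lemma sum_bool_cexp (θ : ℝ) :
    ∑ b : Bool, Complex.exp ((boolSign b * θ : ℝ) * Complex.I) = 2 * (Real.cos θ : ℂ) := by
  simp only [Fintype.sum_bool, boolSign, Complex.ofReal_cos, Complex.cos]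
  simp
  ring

lemma sum_cexp_linear {ι : Type*} [Fintype ι] [DecidableEq ι] (θ : ι → ℝ) :
    ∑ z : ι → Bool, Complex.exp ((∑ i, boolSign (z i) * θ i : ℝ) * Complex.I)
      = 2 ^ Fintype.card ι * ∏ i, (Real.cos (θ i) : ℂ) := by
  have h := Finset.prod_univ_sum (fun _ : ι => (Finset.univ : Finset Bool))
    (fun i b => Complex.exp ((boolSign b * θ i : ℝ) * Complex.I))
  rw [Fintype.piFinset_univ] at h
  simp_rw [sum_bool_cexp] at h
  rw [Finset.prod_mul_distrib] at h
  simp only [Finset.prod_const, Finset.card_univ] at h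
  rw [h]
  apply Finset.sum_congr rfl
  intro z _
  rw [← Complex.exp_sum, Complex.ofReal_sum, Finset.sum_mul]

/-- Decoupling: an exponential sum over signs `(z, y)` whose phase is bilinear up to terms depending
on `z` only and on `y` only is controlled by the bilinear part. -/
lemma norm_sq_sum_cexp_bilinear_le {I J : Type*} [Fintype I] [Fintype J] [DecidableEq I]
    [DecidableEq J] (A : (I → Bool) → ℝ) (B : (J → Bool) → ℝ) (m : I → J → ℝ) :
    ‖∑ z : I → Bool, ∑ y : J → Bool, Complex.exp
        ((A z + B y + ∑ i, boolSign (z i) * ∑ j, m i j * boolSign (y j) : ℝ) * Complex.I)‖ ^ 2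
      ≤ (2 ^ Fintype.card I) ^ 2 * ∑ y : J → Bool, ∑ y' : J → Bool,
          ∏ i, |Real.cos (∑ j, m i j * (boolSign (y j) - boolSign (y' j)))| := by
  set F : (I → Bool) → (J → Bool) → ℝ := fun z y =>
    A z + B y + ∑ i, boolSign (z i) * ∑ j, m i j * boolSign (y j) with hF
  set N : ℝ := 2 ^ Fintype.card I with hN
  -- After Cauchy–Schwarz in z, expanding the square in y cancels `A z`, while the `B` terms become
  -- unimodular factors. The phase left is linear in z, and its sum over signs is a product of
  -- cosines.
  have hcs : ‖∑ z, ∑ y, Complex.exp ((F z y : ℝ) * Complex.I)‖ ^ 2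
      ≤ N * ∑ z, ‖∑ y, Complex.exp ((F z y : ℝ) * Complex.I)‖ ^ 2 := by
    calc _ ≤ (∑ z, ‖∑ y, Complex.exp ((F z y : ℝ) * Complex.I)‖) ^ 2 := by
          gcongr
          exact norm_sum_le _ _
      _ ≤ _ := by
        refine sq_sum_le_card_mul_sum_sq.trans_eq ?_
        simp [hN]
  have hexp : ((∑ z, ‖∑ y, Complex.exp ((F z y : ℝ) * Complex.I)‖ ^ 2 : ℝ) : ℂ)
      = ∑ y, ∑ y', Complex.exp ((B y - B y' : ℝ) * Complex.I) * ∑ z : I → Bool,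
        Complex.exp ((∑ i, boolSign (z i) *
          ∑ j, m i j * (boolSign (y j) - boolSign (y' j)) : ℝ) * Complex.I) := by
    have h1 : ∀ z, ((‖∑ y, Complex.exp ((F z y : ℝ) * Complex.I)‖ ^ 2 : ℝ) : ℂ)
        = ∑ y, ∑ y', Complex.exp ((F z y - F z y' : ℝ) * Complex.I) := by
      intro z
      rw [← Complex.normSq_eq_norm_sq, ← Complex.mul_conj, map_sum, Finset.sum_mul_sum]
      refine Finset.sum_congr rfl fun y _ => Finset.sum_congr rfl fun y' _ => ?_
      rw [← Complex.exp_conj, ← Complex.exp_add]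
      congr 1
      simp
      ring
    rw [Complex.ofReal_sum, Finset.sum_congr rfl fun z _ => h1 z, Finset.sum_comm]
    refine Finset.sum_congr rfl fun y _ => ?_
    rw [Finset.sum_comm]
    refine Finset.sum_congr rfl fun y' _ => ?_
    rw [Finset.mul_sum]
    refine Finset.sum_congr rfl fun z _ => ?_
    rw [← Complex.exp_add, ← add_mul, ← Complex.ofReal_add]
    congr 3
    have : ∑ i, boolSign (z i) * ∑ j, m i j * (boolSign (y j) - boolSign (y' j))
        = ∑ i, boolSign (z i) * ∑ j, m i j * boolSign (y j)
          - ∑ i, boolSign (z i) * ∑ j, m i j * boolSign (y' j) := by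
      simp_rw [mul_sub, Finset.sum_sub_distrib, mul_sub, Finset.sum_sub_distrib]
    rw [this]
    simp only [hF]
    ring
  have hle : ∑ z, ‖∑ y, Complex.exp ((F z y : ℝ) * Complex.I)‖ ^ 2
      ≤ ∑ y : J → Bool, ∑ y' : J → Bool, N *
          ∏ i, |Real.cos (∑ j, m i j * (boolSign (y j) - boolSign (y' j)))| := by
    have h0 : (0 : ℝ) ≤ ∑ z, ‖∑ y, Complex.exp ((F z y : ℝ) * Complex.I)‖ ^ 2 :=
      Finset.sum_nonneg fun _ _ => by positivity
    rw [← Real.norm_of_nonneg h0, ← Complex.norm_real, hexp]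
    refine (norm_sum_le _ _).trans (Finset.sum_le_sum fun y _ => ?_)
    refine (norm_sum_le _ _).trans (Finset.sum_le_sum fun y' _ => ?_)
    rw [norm_mul, Complex.norm_exp_ofReal_mul_I, one_mul, sum_cexp_linear, norm_mul, norm_prod]
    simp only [Complex.norm_real, Real.norm_eq_abs]
    simp [hN]
  refine hcs.trans ?_
  simp_rw [← Finset.mul_sum] at hle
  have hN0 : 0 ≤ N := by positivity
  calc _ ≤ N * (N * _) := mul_le_mul_of_nonneg_left hle hN0
    _ = _ := by ring

/-! ### Expansion of cosine powers and moments. -/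

/-- The symmetric binomial weights `2 ^ (-2 h) * (2 h).choose (h + u)`. -/
noncomputable def binomWeight (h u : ℕ) : ℝ := ((2 * h).choose (h + u) : ℝ) / 4 ^ h

lemma binomWeight_nonneg (h u : ℕ) : 0 ≤ binomWeight h u := by
  unfold binomWeight; positivity

lemma cos_pow_eq_sum (h : ℕ) (θ : ℝ) :
    ((Real.cos θ ^ (2 * h) : ℝ) : ℂ) = ∑ v ∈ Finset.Icc (-(h : ℤ)) h,
      (binomWeight h v.natAbs : ℂ) * Complex.exp ((v * (2 * θ) : ℝ) * Complex.I) := by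
  have h1 : ((Real.cos θ ^ (2 * h) : ℝ) : ℂ) = ∑ b ∈ Finset.range (2 * h + 1),
      (Complex.exp (θ * Complex.I) ^ b * Complex.exp (-θ * Complex.I) ^ (2 * h - b)
        * ((2 * h).choose b : ℂ)) / 4 ^ h := by
    rw [← Finset.sum_div, ← add_pow]
    push_cast
    rw [Complex.cos, div_pow, pow_mul 2]
    norm_num
  rw [h1]
  -- The frequency v is b - h; the symmetry of binomial coefficients lets the weight depend on |v|
  -- only.
  refine Finset.sum_bij' (fun b _ => (b : ℤ) - h) (fun v _ => (v + h).toNat) ?_ ?_ ?_ ?_ ?_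
  · intro b hb; simp at hb ⊢; omega
  · intro b hb; simp at hb ⊢; omega
  · intro b hb; simp at hb ⊢
  · intro b hb; simp at hb ⊢; omega
  · intro b hb
    have hb' : b ≤ 2 * h := by simp at hb; omega
    have hc : (2 * h).choose (h + ((b : ℤ) - h).natAbs) = (2 * h).choose b := by
      rcases le_total h b with hhb | hhb
      · congr 1; omega
      · rw [← Nat.choose_symm hb']
        congr 1; omega
    have he : Complex.exp (θ * Complex.I) ^ b * Complex.exp (-θ * Complex.I) ^ (2 * h - b)
        = Complex.exp (((((b : ℤ) - h : ℤ) : ℝ) * (2 * θ) : ℝ) * Complex.I) := by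
      rw [← Complex.exp_nat_mul, ← Complex.exp_nat_mul, ← Complex.exp_add]
      congr 1
      rw [Nat.cast_sub hb']
      push_cast
      ring
    rw [he, binomWeight, hc]
    push_cast
    ring

/-- Moments of the cosines of the decoupled linear forms, computed by expanding the powers. -/
lemma sum_sum_prod_cos_pow {K J : Type*} [Fintype K] [Fintype J] [DecidableEq K] [DecidableEq J]
    (h : ℕ) (w : K → J → ℝ) :
    ∑ y : J → Bool, ∑ y' : J → Bool,
        ∏ k, Real.cos (∑ j, w k j * (boolSign (y j) - boolSign (y' j))) ^ (2 * h)
      = (2 ^ Fintype.card J) ^ 2 * ∑ V ∈ Fintype.piFinset fun _ : K => Finset.Icc (-(h : ℤ)) h,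
          (∏ k, binomWeight h (V k).natAbs) * ∏ j, Real.cos (2 * ∑ k, V k * w k j) ^ 2 := by
  have hC : ∀ y y' : J → Bool,
      ((∏ k, Real.cos (∑ j, w k j * (boolSign (y j) - boolSign (y' j))) ^ (2 * h) : ℝ) : ℂ)
      = ∑ V ∈ Fintype.piFinset fun _ : K => Finset.Icc (-(h : ℤ)) h,
          ((∏ k, binomWeight h (V k).natAbs : ℝ) : ℂ) *
          (Complex.exp ((∑ j, boolSign (y j) * (2 * ∑ k, V k * w k j) : ℝ) * Complex.I) *
          Complex.exp ((∑ j, boolSign (y' j) * -(2 * ∑ k, V k * w k j) : ℝ) * Complex.I)) := by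
    intro y y'
    rw [Complex.ofReal_prod, Finset.prod_congr rfl fun k _ => cos_pow_eq_sum h _,
      Finset.prod_univ_sum]
    refine Finset.sum_congr rfl fun V _ => ?_
    rw [Finset.prod_mul_distrib, Complex.ofReal_prod]
    congr 1
    rw [← Complex.exp_sum, ← Complex.exp_add, ← add_mul, ← Complex.ofReal_add, ← Finset.sum_mul,
      ← Complex.ofReal_sum]
    congr 3
    rw [← Finset.sum_add_distrib]
    simp_rw [Finset.mul_sum]
    rw [Finset.sum_comm]
    refine Finset.sum_congr rfl fun j _ => ?_
    rw [← Finset.sum_neg_distrib, Finset.mul_sum, ← Finset.sum_add_distrib]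
    refine Finset.sum_congr rfl fun k _ => ?_
    ring
  have key : ((∑ y : J → Bool, ∑ y' : J → Bool,
        ∏ k, Real.cos (∑ j, w k j * (boolSign (y j) - boolSign (y' j))) ^ (2 * h) : ℝ) : ℂ)
      = (((2 ^ Fintype.card J) ^ 2 *
        ∑ V ∈ Fintype.piFinset fun _ : K => Finset.Icc (-(h : ℤ)) h,
          (∏ k, binomWeight h (V k).natAbs) * ∏ j, Real.cos (2 * ∑ k, V k * w k j) ^ 2 : ℝ) : ℂ) := by
    rw [Complex.ofReal_sum]
    simp_rw [Complex.ofReal_sum, hC]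
    simp_rw [Finset.sum_comm (s := (Finset.univ : Finset (J → Bool)))
      (t := Fintype.piFinset fun _ : K => Finset.Icc (-(h : ℤ)) h)]
    rw [Complex.ofReal_mul, Complex.ofReal_sum, Finset.mul_sum]
    refine Finset.sum_congr rfl fun V _ => ?_
    -- For fixed V the sums over y and y' factor; each equals the same product of cosines, whence
    -- the square.
    simp_rw [← Finset.mul_sum]
    rw [← Finset.sum_mul]
    simp_rw [sum_cexp_linear, Real.cos_neg]
    push_cast
    rw [Finset.prod_pow]
    ring
  exact_mod_cast key

/-- AM–GM applied to the powers `G i ^ s.card`. It replaces the product over all tuples by an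
average of terms, each involving a single tuple. -/
lemma prod_le_average_pow {ι : Type*} (s : Finset ι) (hs : s.Nonempty) (G : ι → ℝ)
    (hG : ∀ i ∈ s, 0 ≤ G i) : ∏ i ∈ s, G i ≤ (∑ i ∈ s, G i ^ s.card) / s.card := by
  have hc : (0 : ℝ) < s.card := by exact_mod_cast hs.card_pos
  have h := Real.geom_mean_le_arith_mean_weighted s (fun _ => (s.card : ℝ)⁻¹)
    (fun i => G i ^ s.card) (fun _ _ => by positivity)
    (by simp [hc.ne']) (fun i hi => pow_nonneg (hG i hi) _)
  rw [Finset.prod_congr rfl fun i hi =>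
    Real.pow_rpow_inv_natCast (hG i hi) hs.card_pos.ne'] at h
  rw [← Finset.mul_sum] at h
  rwa [div_eq_inv_mul]

/-! ### Size and summation of the binomial weights. -/

lemma binomWeight_antitone (h : ℕ) : Antitone (binomWeight h) := by
  refine antitone_nat_of_succ_le fun u => ?_
  unfold binomWeight
  gcongr
  have h1 := Nat.choose_succ_right_eq (2 * h) (h + u)
  have h2 : 2 * h - (h + u) ≤ h + u + 1 := by omega
  have h3 : (2 * h).choose (h + u + 1) * (h + u + 1) ≤ (2 * h).choose (h + u) * (h + u + 1) :=
    h1.trans_le (Nat.mul_le_mul_left _ h2)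
  exact Nat.le_of_mul_le_mul_right h3 (by omega)

/-- By induction: the left side is multiplied at each step by (2k+1)(2k+3)/(2k+2)² ≤ 1. -/
lemma binomWeight_zero_sq_le (h : ℕ) : binomWeight h 0 ^ 2 * (2 * h + 1) ≤ 1 := by
  have h0 : ∀ h, binomWeight h 0 = (Nat.centralBinom h : ℝ) / 4 ^ h := by
    intro h; simp [binomWeight, Nat.centralBinom]
  rw [h0]
  induction h with
  | zero => simp
  | succ k ih =>
    have hrec : ((k : ℝ) + 1) * (Nat.centralBinom (k + 1) : ℝ)
        = 2 * (2 * k + 1) * Nat.centralBinom k := by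
      exact_mod_cast Nat.succ_mul_centralBinom_succ k
    set c := (Nat.centralBinom k : ℝ) / 4 ^ k with hc
    have hstep : (Nat.centralBinom (k + 1) : ℝ) / 4 ^ (k + 1)
        = (2 * k + 1) / (2 * k + 2) * c := by
      rw [hc, pow_succ]
      field_simp
      linear_combination 2 * hrec
    rw [hstep]
    push_cast
    have hk : (0 : ℝ) ≤ k := Nat.cast_nonneg k
    have h1 : ((2 * (k : ℝ) + 1) / (2 * k + 2) * c) ^ 2 * (2 * (k + 1) + 1)
        = (c ^ 2 * (2 * k + 1)) * ((2 * k + 1) * (2 * k + 3) / (2 * k + 2) ^ 2) := by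
      field_simp
      ring
    rw [h1]
    have h2 : (2 * (k : ℝ) + 1) * (2 * k + 3) / (2 * k + 2) ^ 2 ≤ 1 := by
      rw [div_le_one (by positivity)]
      nlinarith
    exact mul_le_one₀ ih (by positivity) h2

lemma binomWeight_zero_le (h : ℕ) : binomWeight h 0 ≤ 1 / √(2 * h + 1) := by
  have hp : (0 : ℝ) < 2 * h + 1 := by positivity
  rw [le_div_iff₀ (Real.sqrt_pos.2 hp)]
  have h1 := binomWeight_zero_sq_le h
  rw [← Real.sq_sqrt hp.le, ← mul_pow] at h1
  exact le_of_sq_le_sq (by simpa using h1) zero_le_one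

lemma sum_binomWeight_le_one (h N : ℕ) : ∑ u ∈ Finset.range N, binomWeight h u ≤ 1 := by
  unfold binomWeight
  rw [← Finset.sum_div, div_le_one (by positivity)]
  have h1 : ∑ u ∈ Finset.range N, (2 * h).choose (h + u) ≤ 4 ^ h := by
    calc ∑ u ∈ Finset.range N, (2 * h).choose (h + u)
        = ∑ b ∈ (Finset.range N).map (addLeftEmbedding h), (2 * h).choose b := by simp
      _ ≤ ∑ b ∈ Finset.range (2 * h + 1), (2 * h).choose b := by
        apply Finset.sum_le_sum_of_ne_zero
        intro b _ hb
        rw [Finset.mem_range]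
        by_contra hlt
        exact hb (Nat.choose_eq_zero_of_lt (by omega))
      _ = 4 ^ h := by rw [Nat.sum_range_choose, pow_mul]; norm_num
  exact_mod_cast h1

/-- Each value at a positive multiple of ℓ is at most the average of g over the ℓ integers before
it. Only the value at 0 has no such block. -/
lemma sum_multiples_le_of_antitone {g : ℕ → ℝ} (hg : Antitone g) {ℓ : ℕ} (hℓ : 0 < ℓ)
    (h0 : ∀ u, 0 ≤ g u) (N : ℕ) :
    ∑ q ∈ Finset.range N, g (ℓ * q) ≤ g 0 + (∑ u ∈ Finset.range (ℓ * N), g u) / ℓ := by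
  have hℓ' : (0 : ℝ) < ℓ := by exact_mod_cast hℓ
  suffices H : ∀ N : ℕ, ∑ q ∈ Finset.range N, g (ℓ * (q + 1))
      ≤ (∑ u ∈ Finset.range (ℓ * N), g u) / ℓ by
    have h1 : ∑ q ∈ Finset.range N, g (ℓ * q) ≤ ∑ q ∈ Finset.range (N + 1), g (ℓ * q) :=
      Finset.sum_le_sum_of_subset_of_nonneg (Finset.range_subset_range.2 (Nat.le_succ N))
        (fun _ _ _ => h0 _)
    rw [Finset.sum_range_succ'] at h1
    simp only [mul_zero] at h1
    linarith [H N]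
  intro N
  induction N with
  | zero => simp
  | succ N ih =>
    rw [Finset.sum_range_succ, mul_add, mul_one, Finset.sum_range_add, add_div]
    refine add_le_add ih ?_
    rw [le_div_iff₀ hℓ']
    calc g (ℓ * (N + 1)) * ℓ = ∑ _i ∈ Finset.range ℓ, g (ℓ * (N + 1)) := by
          simp [mul_comm]
      _ ≤ ∑ i ∈ Finset.range ℓ, g (ℓ * N + i) := by
        apply Finset.sum_le_sum
        intro i hi
        apply hg
        rw [Finset.mem_range] at hi
        nlinarith

/-! ### Sums over the integers and Gaussian sums. -/

/-- The two-to-one map `ℤ → ℕ` sending both `n` and `-(n + 1)` to `n`. -/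
def intFold : ℤ → ℕ
  | Int.ofNat n => n
  | Int.negSucc n => n

lemma intFold_of_nonneg {v : ℤ} (hv : 0 ≤ v) : (intFold v : ℤ) = v := by
  cases v with
  | ofNat n => rfl
  | negSucc n => omega

lemma intFold_of_neg {v : ℤ} (hv : v < 0) : (intFold v : ℤ) = -v - 1 := by
  cases v with
  | ofNat n => simp at hv; omega
  | negSucc n => simp [intFold]

lemma sum_intFold_le {F : ℕ → ℝ} (hF : ∀ u, 0 ≤ F u) {S : Finset ℤ} {N : ℕ}
    (hS : S ⊆ Finset.Ico (-(N : ℤ)) N) :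
    ∑ v ∈ S, F (intFold v) ≤ 2 * ∑ u ∈ Finset.range N, F u := by
  refine (Finset.sum_le_sum_of_subset_of_nonneg hS fun _ _ _ => hF _).trans_eq ?_
  clear hS
  induction N with
  | zero => simp
  | succ N ih =>
    have : Finset.Ico (-((N + 1 : ℕ) : ℤ)) ((N + 1 : ℕ) : ℤ)
        = insert (Int.ofNat N) (insert (Int.negSucc N) (Finset.Ico (-(N : ℤ)) N)) := by
      ext v
      simp only [Finset.mem_Ico, Finset.mem_insert, Int.negSucc_eq, Int.ofNat_eq_natCast]
      omega
    rw [this, Finset.sum_insert, Finset.sum_insert, ih, Finset.sum_range_succ]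
    · simp only [intFold]; ring
    · simp only [Finset.mem_Ico, Int.negSucc_eq]; omega
    · simp only [Finset.mem_insert, Finset.mem_Ico, Int.negSucc_eq, Int.ofNat_eq_natCast]; omega

lemma sum_exp_neg_mul_le {a : ℝ} (ha : 0 < a) (N : ℕ) :
    ∑ u ∈ Finset.range N, Real.exp (-(a * u)) ≤ 1 + 1 / a := by
  have hlt : Real.exp (-a) < 1 := by simpa using ha
  have h1 : ∀ u : ℕ, Real.exp (-(a * u)) = Real.exp (-a) ^ u := by
    intro u
    rw [← Real.exp_nat_mul]
    congr 1
    ring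
  simp_rw [h1]
  refine ((summable_geometric_of_lt_one (Real.exp_pos _).le hlt).sum_le_tsum _
    (fun _ _ => by positivity)).trans ?_
  rw [tsum_geometric_of_lt_one (Real.exp_pos _).le hlt]
  have h2 : Real.exp (-a) ≤ 1 / (1 + a) := by
    rw [Real.exp_neg, ← one_div]
    gcongr
    linarith [Real.add_one_le_exp a]
  have h3 : a / (1 + a) ≤ 1 - Real.exp (-a) := by
    have : a / (1 + a) = 1 - 1 / (1 + a) := by field_simp; ring
    linarith
  calc (1 - Real.exp (-a))⁻¹ ≤ (a / (1 + a))⁻¹ := by gcongr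
    _ = 1 + 1 / a := by field_simp; ring

lemma sum_gaussian_le {a : ℝ} (ha : 0 < a) (S : Finset ℤ) (v₀ : ℤ) :
    ∑ v ∈ S, Real.exp (-(a ^ 2 * ((v - v₀ : ℤ) : ℝ) ^ 2)) ≤ 4 * (1 + 1 / a) := by
  set S' := S.image (fun v => v - v₀) with hS'
  have h1 : ∑ v ∈ S, Real.exp (-(a ^ 2 * ((v - v₀ : ℤ) : ℝ) ^ 2))
      = ∑ v ∈ S', Real.exp (-(a ^ 2 * (v : ℝ) ^ 2)) := by
    rw [hS', Finset.sum_image]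
    intro x _ y _ hxy
    simpa using hxy
  have h2 : ∀ v : ℤ, Real.exp (-(a ^ 2 * (v : ℝ) ^ 2))
      ≤ 2 * Real.exp (-(a * intFold v)) := by
    intro v
    have hfold : (intFold v : ℝ) ≤ |(v : ℝ)| := by
      have : (intFold v : ℤ) ≤ |v| := by
        rcases le_or_gt 0 v with hv | hv
        · rw [intFold_of_nonneg hv]; exact le_abs_self v
        · rw [intFold_of_neg hv, abs_of_neg hv]; omega
      exact_mod_cast this
    have he : (2 : ℝ) ≥ Real.exp (1 / 4) := by
      have h4 := Real.exp_one_lt_d9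
      have h5 : Real.exp (1 / 4) ^ 4 = Real.exp 1 := by
        rw [← Real.exp_nat_mul]; norm_num
      by_contra hlt
      push Not at hlt
      have : (2 : ℝ) ^ 4 ≤ Real.exp (1 / 4) ^ 4 := by gcongr
      linarith
    calc Real.exp (-(a ^ 2 * (v : ℝ) ^ 2))
        ≤ Real.exp (1 / 4 + -(a * intFold v)) := by
          apply Real.exp_le_exp.2
          have : a * intFold v ≤ a * |(v : ℝ)| := by gcongr
          rw [← sq_abs (v : ℝ)]
          nlinarith [sq_nonneg (a * |(v : ℝ)| - 1 / 2)]
      -- From x² ≥ x - 1/4 with x = a|v|: the Gaussian is dominated by a geometric series at the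
      -- cost of exp(1/4) ≤ 2.
      _ = Real.exp (1 / 4) * Real.exp (-(a * intFold v)) := Real.exp_add _ _
      _ ≤ _ := by gcongr
  rw [h1]
  have h3 : S' ⊆ Finset.Ico (-((S'.sup Int.natAbs + 1 : ℕ) : ℤ)) ((S'.sup Int.natAbs + 1 : ℕ) : ℤ) := by
    intro v hv
    have := Finset.le_sup (f := Int.natAbs) hv
    rw [Finset.mem_Ico]
    omega
  have h4 := sum_intFold_le (F := fun u => Real.exp (-(a * u))) (fun _ => (Real.exp_pos _).le) h3
  have h5 := sum_exp_neg_mul_le ha (S'.sup Int.natAbs + 1)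
  calc _ ≤ ∑ v ∈ S', 2 * Real.exp (-(a * intFold v)) := Finset.sum_le_sum fun v _ => h2 v
    _ = 2 * ∑ v ∈ S', Real.exp (-(a * intFold v)) := by rw [Finset.mul_sum]
    _ ≤ _ := by linarith

/-! ### Products of squared cosines on boxes and their weighted sum. -/

lemma sin_sub_sq_le (a b : ℝ) :
    Real.sin (a - b) ^ 2 ≤ 2 * (Real.sin a ^ 2 + Real.sin b ^ 2) := by
  rw [Real.sin_sub]
  have h1 : (Real.sin a * Real.cos b) ^ 2 ≤ Real.sin a ^ 2 := by
    rw [mul_pow]; nlinarith [Real.cos_sq_le_one b, sq_nonneg (Real.sin a)]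
  have h2 : (Real.cos a * Real.sin b) ^ 2 ≤ Real.sin b ^ 2 := by
    rw [mul_pow]; nlinarith [Real.cos_sq_le_one a, sq_nonneg (Real.sin b)]
  nlinarith [sq_nonneg (Real.sin a * Real.cos b + Real.cos a * Real.sin b)]

lemma sq_div_four_le_sin_sq {x : ℝ} (hx : |x| ≤ 1) : x ^ 2 / 4 ≤ Real.sin x ^ 2 := by
  have hpi := Real.pi_gt_three
  have h1 := Real.mul_abs_le_abs_sin (x := x) (by linarith)
  have h2 : (1 / 2 : ℝ) ≤ 2 / Real.pi := by
    rw [div_le_div_iff₀ (by norm_num) Real.pi_pos]; linarith [Real.pi_le_four]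
  have h3 : 1 / 2 * |x| ≤ |Real.sin x| :=
    (mul_le_mul_of_nonneg_right h2 (abs_nonneg x)).trans h1
  rw [← sq_abs x, ← sq_abs (Real.sin x)]
  nlinarith [abs_nonneg x]

lemma prod_cos_sq_le_exp {J : Type*} [Fintype J] (θ : J → ℝ) :
    ∏ j, Real.cos (θ j) ^ 2 ≤ Real.exp (-∑ j, Real.sin (θ j) ^ 2) := by
  rw [← Finset.sum_neg_distrib, Real.exp_sum]
  apply Finset.prod_le_prod
  · intros; positivity
  · intro j _
    rw [Real.cos_sq']
    linarith [Real.add_one_le_exp (-Real.sin (θ j) ^ 2)]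

/-- Inside a box of side `ℓ`, the products of squared cosines of non-degenerate linear forms have a
bounded sum: they decay in a Gaussian way away from the largest one. -/
lemma sum_box_prod_cos_sq_le {K J : Type*} [Fintype K] [Fintype J] [DecidableEq K]
    {ℓ : ℕ} {τ δ κ : ℝ} (hτ : 0 < τ) (hδ : 0 < δ) (hκ : 0 < κ)
    (hℓτ : 2 * τ * Fintype.card K * ℓ ≤ 1) (w : K → J → ℝ) (hw : ∀ k j, |w k j| ≤ 1)
    (hnd : ∀ V : K → ℝ, V ≠ 0 → κ ≤ ((Finset.univ.filter fun j =>
      δ ^ 2 * ∑ k, V k ^ 2 ≤ (∑ k, V k * w k j) ^ 2).card : ℝ))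
    (S : K → Finset ℤ) (D : Finset (K → ℤ)) (hDS : D ⊆ Fintype.piFinset S)
    (hD : ∀ V ∈ D, ∀ V' ∈ D, ∀ k, |V k - V' k| ≤ ℓ) :
    ∑ V ∈ D, ∏ j, Real.cos (2 * ∑ k, V k * (τ * w k j)) ^ 2
      ≤ (4 * (1 + 2 / (√κ * δ * τ))) ^ Fintype.card K := by
  rcases D.eq_empty_or_nonempty with rfl | hne
  · simp only [Finset.sum_empty]; positivity
  set θ : (K → ℤ) → J → ℝ := fun V j => 2 * ∑ k, V k * (τ * w k j) with hθ
  set E : (K → ℤ) → ℝ := fun V => ∑ j, Real.sin (θ V j) ^ 2 with hE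
  -- The Gaussian is centred at the minimiser of E, the sum of sin². If E is small at V, it is small
  -- at V₀ too, hence so is the sum of sin² of the phase differences, which depends on V - V₀ only.
  obtain ⟨V₀, hV₀, hmin⟩ := D.exists_min_image E hne
  set a : ℝ := √κ * δ * τ / 2 with ha
  have hsκ : 0 < √κ := Real.sqrt_pos.2 hκ
  have ha0 : 0 < a := by positivity
  have ha2 : a ^ 2 = κ * δ ^ 2 * τ ^ 2 / 4 := by
    rw [ha, div_pow, mul_pow, mul_pow, Real.sq_sqrt hκ.le]; norm_num
  have hsub : ∀ V j, θ V j - θ V₀ j = 2 * τ * ∑ k, ((V k - V₀ k : ℤ) : ℝ) * w k j := by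
    intro V j
    simp only [hθ]
    rw [← mul_sub, ← Finset.sum_sub_distrib, mul_assoc 2 τ, Finset.mul_sum (a := τ)]
    congr 1
    refine Finset.sum_congr rfl fun k _ => ?_
    push_cast
    ring
  have hlow : ∀ V ∈ D, a ^ 2 * ∑ k, ((V k - V₀ k : ℤ) : ℝ) ^ 2 ≤ E V := by
    intro V hV
    have h1 : ∑ j, Real.sin (θ V j - θ V₀ j) ^ 2 ≤ 4 * E V := by
      calc _ ≤ ∑ j, 2 * (Real.sin (θ V j) ^ 2 + Real.sin (θ V₀ j) ^ 2) :=
            Finset.sum_le_sum fun j _ => sin_sub_sq_le _ _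
        _ = 2 * (E V + E V₀) := by rw [← Finset.mul_sum, Finset.sum_add_distrib]
        _ ≤ 4 * E V := by linarith [hmin V hV]
    by_cases hz : (fun k => ((V k - V₀ k : ℤ) : ℝ)) = 0
    · have : ∑ k, ((V k - V₀ k : ℤ) : ℝ) ^ 2 = 0 :=
        Finset.sum_eq_zero fun k _ => by
          have := congrFun hz k
          simp only [Pi.zero_apply] at this
          rw [this]; norm_num
      rw [this, mul_zero]
      exact Finset.sum_nonneg fun _ _ => by positivity
    · set q := ∑ k, ((V k - V₀ k : ℤ) : ℝ) ^ 2 with hq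
      have hq0 : 0 ≤ q := Finset.sum_nonneg fun _ _ => by positivity
      have hn := hnd _ hz
      set G := Finset.univ.filter fun j =>
        δ ^ 2 * q ≤ (∑ k, ((V k - V₀ k : ℤ) : ℝ) * w k j) ^ 2 with hG
      have h2 : ∀ j ∈ G, τ ^ 2 * (δ ^ 2 * q) ≤ Real.sin (θ V j - θ V₀ j) ^ 2 := by
        intro j hj
        have hj' : δ ^ 2 * q ≤ (∑ k, ((V k - V₀ k : ℤ) : ℝ) * w k j) ^ 2 := by
          simpa [hG] using hj
        -- The side ℓ is limited so that phase differences stay in the range where sin is comparable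
        -- to its argument.
        have habs : |θ V j - θ V₀ j| ≤ 1 := by
          rw [hsub, abs_mul, abs_of_pos (by positivity : 0 < 2 * τ)]
          have : |∑ k, ((V k - V₀ k : ℤ) : ℝ) * w k j| ≤ Fintype.card K * ℓ := by
            calc _ ≤ ∑ k, |((V k - V₀ k : ℤ) : ℝ) * w k j| := Finset.abs_sum_le_sum_abs _ _
              _ ≤ ∑ _k : K, (ℓ : ℝ) := by
                apply Finset.sum_le_sum
                intro k _
                have h3 : |((V k - V₀ k : ℤ) : ℝ)| ≤ ℓ := by
                  exact_mod_cast hD V hV V₀ hV₀ k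
                rw [abs_mul]
                calc _ ≤ (ℓ : ℝ) * 1 := mul_le_mul h3 (hw k j) (abs_nonneg _) (by positivity)
                  _ = ℓ := mul_one _
              _ = _ := by simp
          calc _ ≤ 2 * τ * (Fintype.card K * ℓ) := by gcongr
            _ ≤ 1 := by linarith
        refine le_trans ?_ (sq_div_four_le_sin_sq habs)
        rw [hsub, mul_pow]
        have : τ ^ 2 * (δ ^ 2 * q) ≤ τ ^ 2 * (∑ k, ((V k - V₀ k : ℤ) : ℝ) * w k j) ^ 2 := by
          gcongr
        linarith [mul_pow 2 τ 2]
      have h3 : (G.card : ℝ) * (τ ^ 2 * (δ ^ 2 * q)) ≤ ∑ j, Real.sin (θ V j - θ V₀ j) ^ 2 := by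
        calc _ = ∑ _j ∈ G, τ ^ 2 * (δ ^ 2 * q) := by simp
          _ ≤ ∑ j ∈ G, Real.sin (θ V j - θ V₀ j) ^ 2 := Finset.sum_le_sum h2
          _ ≤ _ := Finset.sum_le_sum_of_subset_of_nonneg (Finset.subset_univ _)
            (fun _ _ _ => by positivity)
      have h4 : κ * (τ ^ 2 * (δ ^ 2 * q)) ≤ G.card * (τ ^ 2 * (δ ^ 2 * q)) := by
        gcongr
      rw [ha2]
      linarith
  calc ∑ V ∈ D, ∏ j, Real.cos (θ V j) ^ 2
      ≤ ∑ V ∈ D, ∏ k, Real.exp (-(a ^ 2 * ((V k - V₀ k : ℤ) : ℝ) ^ 2)) := by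
        apply Finset.sum_le_sum
        intro V hV
        refine (prod_cos_sq_le_exp _).trans ?_
        rw [← Real.exp_sum, Finset.sum_neg_distrib, ← Finset.mul_sum]
        exact Real.exp_le_exp.2 (neg_le_neg (hlow V hV))
    _ ≤ ∑ V ∈ Fintype.piFinset S, ∏ k, Real.exp (-(a ^ 2 * ((V k - V₀ k : ℤ) : ℝ) ^ 2)) :=
        Finset.sum_le_sum_of_subset_of_nonneg hDS fun _ _ _ => by positivity
    _ = ∏ k, ∑ v ∈ S k, Real.exp (-(a ^ 2 * ((v - V₀ k : ℤ) : ℝ) ^ 2)) := by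
        rw [Finset.prod_univ_sum]
    _ ≤ ∏ _k : K, (4 * (1 + 1 / a)) :=
        Finset.prod_le_prod (fun _ _ => Finset.sum_nonneg fun _ _ => by positivity)
          fun k _ => sum_gaussian_le ha0 _ _
    _ = (4 * (1 + 2 / (√κ * δ * τ))) ^ Fintype.card K := by
        rw [Finset.prod_const, Finset.card_univ, ha, one_div_div]

/-- Locates the points of a cell relative to the origin. Cells q and -(q + 1) lie symmetrically and
share one bound, which is what `intFold` encodes. -/
lemma mul_intFold_ediv_le_natAbs {ℓ : ℕ} (hℓ : 0 < ℓ) (v : ℤ) :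
    ℓ * intFold (v / ℓ) ≤ v.natAbs := by
  have hℓ' : (0 : ℤ) < ℓ := by exact_mod_cast hℓ
  have h1 := Int.mul_ediv_add_emod v ℓ
  have h2 := Int.emod_nonneg v hℓ'.ne'
  have h3 := Int.emod_lt_of_pos v hℓ'
  zify
  rcases le_or_gt 0 (v / ℓ) with hq | hq
  · rw [intFold_of_nonneg hq]
    exact le_trans (by linarith) (le_abs_self v)
  · rw [intFold_of_neg hq]
    refine le_trans ?_ (neg_le_abs v)
    linarith

/-- The binomially weighted sum of products of squared cosines of non-degenerate linear forms. -/
lemma sum_binomWeight_prod_cos_sq_le {K J : Type*} [Fintype K] [Fintype J] [DecidableEq K]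
    (h : ℕ) {ℓ : ℕ} (hℓ : 0 < ℓ) {τ δ κ : ℝ} (hτ : 0 < τ) (hδ : 0 < δ) (hκ : 0 < κ)
    (hℓτ : 2 * τ * Fintype.card K * ℓ ≤ 1) (w : K → J → ℝ) (hw : ∀ k j, |w k j| ≤ 1)
    (hnd : ∀ V : K → ℝ, V ≠ 0 → κ ≤ ((Finset.univ.filter fun j =>
      δ ^ 2 * ∑ k, V k ^ 2 ≤ (∑ k, V k * w k j) ^ 2).card : ℝ)) :
    ∑ V ∈ Fintype.piFinset fun _ : K => Finset.Icc (-(h : ℤ)) h,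
        (∏ k, binomWeight h (V k).natAbs) * ∏ j, Real.cos (2 * ∑ k, V k * (τ * w k j)) ^ 2
      ≤ (2 * (1 / √(2 * h + 1) + 1 / ℓ) * (4 * (1 + 2 / (√κ * δ * τ)))) ^ Fintype.card K := by
  have hℓ' : (0 : ℤ) < ℓ := by exact_mod_cast hℓ
  set P := Fintype.piFinset fun _ : K => Finset.Icc (-(h : ℤ)) h with hP
  set Q := Fintype.piFinset fun _ : K => Finset.Ico (-((h + 1 : ℕ) : ℤ)) ((h + 1 : ℕ) : ℤ) with hQ
  set c : (K → ℤ) → K → ℤ := fun V k => V k / ℓ with hc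
  have hmaps : ∀ V ∈ P, c V ∈ Q := by
    intro V hV
    simp only [hP, hQ, hc, Fintype.mem_piFinset, Finset.mem_Icc, Finset.mem_Ico] at hV ⊢
    intro k
    obtain ⟨h1, h2⟩ := hV k
    constructor
    · rw [Int.le_ediv_iff_mul_le hℓ']
      push_cast
      nlinarith
    · rw [Int.ediv_lt_iff_lt_mul hℓ']
      push_cast
      nlinarith
  set A : ℝ := (4 * (1 + 2 / (√κ * δ * τ))) ^ Fintype.card K with hA
  have hA0 : 0 ≤ A := by positivity
  rw [← Finset.sum_fiberwise_of_maps_to hmaps]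
  have hcell : ∀ q ∈ Q, ∑ V ∈ P with c V = q,
      (∏ k, binomWeight h (V k).natAbs) * ∏ j, Real.cos (2 * ∑ k, V k * (τ * w k j)) ^ 2
      ≤ (∏ k, binomWeight h (ℓ * intFold (q k))) * A := by
    intro q _
    -- Since the weights decrease in |v|, each is bounded on the cell by its value at the fold of q;
    -- the box estimate handles what remains.
    calc _ ≤ ∑ V ∈ P with c V = q, (∏ k, binomWeight h (ℓ * intFold (q k))) *
          ∏ j, Real.cos (2 * ∑ k, V k * (τ * w k j)) ^ 2 := by
          apply Finset.sum_le_sum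
          intro V hV
          apply mul_le_mul_of_nonneg_right _ (Finset.prod_nonneg fun _ _ => by positivity)
          refine Finset.prod_le_prod (fun _ _ => binomWeight_nonneg _ _) fun k _ => ?_
          apply binomWeight_antitone
          have hq : q k = V k / ℓ := by
            rw [← (Finset.mem_filter.1 hV).2]
          rw [hq]
          exact mul_intFold_ediv_le_natAbs hℓ _
      _ = (∏ k, binomWeight h (ℓ * intFold (q k))) *
          ∑ V ∈ P with c V = q, ∏ j, Real.cos (2 * ∑ k, V k * (τ * w k j)) ^ 2 := by
          rw [Finset.mul_sum]
      _ ≤ _ := by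
          apply mul_le_mul_of_nonneg_left _
            (Finset.prod_nonneg fun _ _ => binomWeight_nonneg _ _)
          refine sum_box_prod_cos_sq_le hτ hδ hκ hℓτ w hw hnd _ _ (Finset.filter_subset _ _) ?_
          intro V hV V' hV' k
          have h1 : V k / ℓ = q k := congrFun (Finset.mem_filter.1 hV).2 k
          have h2 : V' k / ℓ = q k := congrFun (Finset.mem_filter.1 hV').2 k
          have e1 := Int.mul_ediv_add_emod (V k) ℓ
          have e2 := Int.mul_ediv_add_emod (V' k) ℓ
          rw [h1] at e1
          rw [h2] at e2
          have a1 := Int.emod_nonneg (V k) hℓ'.ne'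
          have a2 := Int.emod_lt_of_pos (V k) hℓ'
          have a3 := Int.emod_nonneg (V' k) hℓ'.ne'
          have a4 := Int.emod_lt_of_pos (V' k) hℓ'
          rw [abs_le]
          constructor <;> linarith
  have hB : ∑ q ∈ Finset.Ico (-((h + 1 : ℕ) : ℤ)) ((h + 1 : ℕ) : ℤ),
      binomWeight h (ℓ * intFold q) ≤ 2 * (1 / √(2 * h + 1) + 1 / ℓ) := by
    refine (sum_intFold_le (F := fun u => binomWeight h (ℓ * u))
      (fun _ => binomWeight_nonneg _ _) subset_rfl).trans ?_
    gcongr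
    refine (sum_multiples_le_of_antitone (binomWeight_antitone h) hℓ
      (binomWeight_nonneg h) _).trans ?_
    gcongr
    · exact binomWeight_zero_le h
    · exact sum_binomWeight_le_one _ _
  refine (Finset.sum_le_sum hcell).trans ?_
  rw [← Finset.sum_mul, mul_pow]
  apply mul_le_mul_of_nonneg_right _ hA0
  rw [hQ, ← Finset.prod_univ_sum
    (fun _ : K => Finset.Ico (-((h + 1 : ℕ) : ℤ)) ((h + 1 : ℕ) : ℤ))
    (fun _ q => binomWeight h (ℓ * intFold q)), Finset.prod_const, Finset.card_univ]
  exact pow_le_pow_left₀ (Finset.sum_nonneg fun _ _ => binomWeight_nonneg _ _) hB _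

/-! ### Decoupling of the quadratic polynomial through tuples of rows. -/

lemma sum_sum_eq_blocks {ι : Type*} [Fintype ι] (p : ι → Prop) [DecidablePred p]
    (F : ι → ι → ℝ) :
    ∑ i, ∑ j, F i j = (∑ i : {i // p i}, ∑ j : {j // p j}, F i j)
      + (∑ i : {i // ¬p i}, ∑ j : {j // ¬p j}, F i j)
      + ∑ i : {i // p i}, ∑ j : {j // ¬p j}, (F i j + F j i) := by
  have h1 : ∀ G : ι → ℝ, ∑ i, G i = (∑ i : {i // p i}, G i) + ∑ i : {i // ¬p i}, G i :=
    fun G => (Fintype.sum_subtype_add_sum_subtype p G).symm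
  rw [h1 fun i => ∑ j, F i j]
  simp_rw [fun i => h1 (F i), Finset.sum_add_distrib]
  rw [Finset.sum_comm (s := (Finset.univ : Finset {i // ¬p i}))
    (t := (Finset.univ : Finset {i // p i}))]
  ring

/-- A quadratic polynomial is bilinear in two complementary blocks of variables, up to terms that
depend on one of the blocks only. -/
lemma exists_quadraticPoly_eq_add_bilinear {n : ℕ} (a : Fin n → Fin n → ℝ) (b : Fin n → ℝ) (c : ℝ)
    (p : Fin n → Prop) [DecidablePred p] :
    ∃ (A : ({i // p i} → ℝ) → ℝ) (B : ({i // ¬p i} → ℝ) → ℝ), ∀ x : Fin n → ℝ,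
      quadraticPoly a b c x = A (fun i => x i) + B (fun i => x i)
        + ∑ i : {i // p i}, x i * ∑ j : {j // ¬p j}, coeffMatrix a i j * x j := by
  refine ⟨fun z => (∑ i : {i // p i}, ∑ j : {j // p j},
      (if i.1 ≤ j.1 then a i j else 0) * z i * z j) + ∑ i : {i // p i}, b i * z i + c,
    fun y => (∑ i : {i // ¬p i}, ∑ j : {j // ¬p j},
      (if i.1 ≤ j.1 then a i j else 0) * y i * y j) + ∑ i : {i // ¬p i}, b i * y i, ?_⟩
  intro x
  have h1 : ∑ i, ∑ j ∈ Finset.Ici i, a i j * x i * x j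
      = ∑ i, ∑ j, (if i ≤ j then a i j else 0) * x i * x j := by
    refine Finset.sum_congr rfl fun i _ => ?_
    have : Finset.Ici i = Finset.univ.filter (fun j => i ≤ j) := by ext; simp
    rw [this, Finset.sum_filter]
    refine Finset.sum_congr rfl fun j _ => ?_
    split_ifs <;> simp
  have h2 : ∑ i, b i * x i
      = (∑ i : {i // p i}, b i * x i) + ∑ i : {i // ¬p i}, b i * x i :=
    (Fintype.sum_subtype_add_sum_subtype p fun i => b i * x i).symm
  have h3 : ∀ (i : {i // p i}) (j : {j // ¬p j}),
      (if i.1 ≤ j.1 then a i j else 0) * x i * x j + (if j.1 ≤ i.1 then a j i else 0) * x j * x i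
        = x i * (coeffMatrix a i j * x j) := by
    intro i j
    have hne : i.1 ≠ j.1 := fun h => j.2 (h ▸ i.2)
    rcases lt_or_gt_of_ne hne with hlt | hlt
    · simp [coeffMatrix, hlt.le, hlt.not_ge]; ring
    · simp [coeffMatrix, hlt.le, hlt.not_ge]; ring
  unfold quadraticPoly
  rw [h1, h2, sum_sum_eq_blocks p]
  simp_rw [h3, ← Finset.mul_sum]
  ring

/-- Decoupling for the exponential sum of a quadratic polynomial over all signs. -/
lemma norm_sq_sum_cexp_quadraticPoly_le {n : ℕ} (a : Fin n → Fin n → ℝ) (b : Fin n → ℝ) (c τ : ℝ)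
    (p : Fin n → Prop) [DecidablePred p] :
    ‖∑ ε : Fin n → Bool, Complex.exp
        ((τ * quadraticPoly a b c (fun i => boolSign (ε i)) : ℝ) * Complex.I)‖ ^ 2
      ≤ (2 ^ Fintype.card {i // p i}) ^ 2 *
        ∑ y : {j // ¬p j} → Bool, ∑ y' : {j // ¬p j} → Bool, ∏ i : {i // p i},
          |Real.cos (∑ j : {j // ¬p j},
            τ * coeffMatrix a i j * (boolSign (y j) - boolSign (y' j)))| := by
  obtain ⟨A, B, hAB⟩ := exists_quadraticPoly_eq_add_bilinear a b c p
  refine le_trans (le_of_eq ?_) (norm_sq_sum_cexp_bilinear_le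
    (fun z => τ * A (fun i => boolSign (z i))) (fun y => τ * B (fun j => boolSign (y j)))
    (fun (i : {i // p i}) (j : {j // ¬p j}) => τ * coeffMatrix a i j))
  congr 2
  rw [← Fintype.sum_prod_type']
  refine Fintype.sum_equiv (Equiv.piEquivPiSubtypeProd p fun _ => Bool) _ _ fun ε => ?_
  congr 3
  rw [hAB]
  simp only [Equiv.piEquivPiSubtypeProd_apply, mul_add, Finset.mul_sum]
  congr 1
  refine Finset.sum_congr rfl fun i _ => Finset.sum_congr rfl fun j _ => ?_
  ring

/-- The exponential sum of a quadratic polynomial, bounded through disjoint tuples of rows. -/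
lemma norm_sq_sum_cexp_quadraticPoly_le_of_tuples {n r h : ℕ} (hh : 0 < h)
    (a : Fin n → Fin n → ℝ) (b : Fin n → ℝ) (c τ D : ℝ)
    (T : Finset (Fin r → Fin n)) (hcard : T.card = 2 * h)
    (hdisj : (T : Set (Fin r → Fin n)).PairwiseDisjoint (fun t => Set.range t))
    (hinj : ∀ t ∈ T, Function.Injective t)
    (p : Fin n → Prop) [DecidablePred p] (hp : ∀ i, p i ↔ ∃ t ∈ T, ∃ k, t k = i)
    (hD : ∀ t ∈ T, ∑ V ∈ Fintype.piFinset fun _ : Fin r => Finset.Icc (-(h : ℤ)) h,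
        (∏ k, binomWeight h (V k).natAbs) * ∏ j : {j // ¬p j},
          Real.cos (2 * ∑ k, V k * (τ * coeffMatrix a (t k) j)) ^ 2 ≤ D) :
    ‖∑ ε : Fin n → Bool, Complex.exp
        ((τ * quadraticPoly a b c (fun i => boolSign (ε i)) : ℝ) * Complex.I)‖ ^ 2
      ≤ (2 ^ n) ^ 2 * D := by
  classical
  refine (norm_sq_sum_cexp_quadraticPoly_le a b c τ p).trans ?_
  have hne : T.Nonempty := Finset.card_pos.1 (by omega)
  have hc0 : (0 : ℝ) < T.card := by exact_mod_cast hne.card_pos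
  have hprod : ∀ G : Fin n → ℝ, (∀ i, 0 ≤ G i) → ∏ i : {i // p i}, G i
      ≤ (∑ t ∈ T, ∏ k, G (t k) ^ (2 * h)) / T.card := by
    intro G hG
    -- Disjointness of the tuples and injectivity of each one make every index of the block occur
    -- exactly once.
    have h1 : ∏ i : {i // p i}, G i = ∏ t ∈ T, ∏ k, G (t k) := by
      have h2 : ∏ i : {i // p i}, G i
          = ∏ i ∈ T.biUnion (fun t => Finset.univ.image t), G i := by
        rw [← Finset.prod_subtype]
        intro i
        simp [hp]
      rw [h2, Finset.prod_biUnion]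
      · refine Finset.prod_congr rfl fun t ht => ?_
        rw [Finset.prod_image fun k _ k' _ h => hinj t ht h]
      · intro t ht t' ht' htt'
        have := hdisj ht ht' htt'
        rw [Function.onFun, ← Finset.disjoint_coe]
        simpa using this
    rw [h1]
    refine (prod_le_average_pow T hne _ fun t _ => Finset.prod_nonneg fun _ _ => hG _).trans_eq ?_
    rw [hcard]
    simp_rw [Finset.prod_pow]
  have hsum : ∑ y : {j // ¬p j} → Bool, ∑ y' : {j // ¬p j} → Bool, ∏ i : {i // p i},
        |Real.cos (∑ j : {j // ¬p j},
          τ * coeffMatrix a i j * (boolSign (y j) - boolSign (y' j)))|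
      ≤ (2 ^ Fintype.card {j // ¬p j}) ^ 2 * D := by
    calc _ ≤ ∑ y : {j // ¬p j} → Bool, ∑ y' : {j // ¬p j} → Bool, (∑ t ∈ T, ∏ k,
          Real.cos (∑ j : {j // ¬p j}, τ * coeffMatrix a (t k) j *
            (boolSign (y j) - boolSign (y' j))) ^ (2 * h)) / T.card := by
          refine Finset.sum_le_sum fun y _ => Finset.sum_le_sum fun y' _ => ?_
          refine (hprod (fun i => |Real.cos (∑ j : {j // ¬p j}, τ * coeffMatrix a i j *
            (boolSign (y j) - boolSign (y' j)))|) fun _ => abs_nonneg _).trans_eq ?_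
          simp_rw [(even_two_mul h).pow_abs]
      _ = (∑ t ∈ T, ∑ y : {j // ¬p j} → Bool, ∑ y' : {j // ¬p j} → Bool, ∏ k,
          Real.cos (∑ j : {j // ¬p j}, τ * coeffMatrix a (t k) j *
            (boolSign (y j) - boolSign (y' j))) ^ (2 * h)) / T.card := by
          simp_rw [← Finset.sum_div]
          congr 1
          simp_rw [Finset.sum_comm (s := (Finset.univ : Finset ({j // ¬p j} → Bool))) (t := T)]
      _ ≤ (∑ _t ∈ T, (2 ^ Fintype.card {j // ¬p j}) ^ 2 * D) / T.card := by
          gcongr with t ht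
          rw [sum_sum_prod_cos_pow h fun k (j : {j // ¬p j}) => τ * coeffMatrix a (t k) j]
          gcongr
          exact hD t ht
      _ = _ := by
          rw [Finset.sum_const, nsmul_eq_mul]
          field_simp
  have hn : (2 : ℝ) ^ n = 2 ^ Fintype.card {i // p i} * 2 ^ Fintype.card {j // ¬p j} := by
    rw [← pow_add]
    congr 1
    have := Fintype.card_subtype_compl p
    have h2 := Fintype.card_subtype_le p
    rw [Fintype.card_fin] at this h2
    omega
  rw [hn, mul_pow, mul_assoc]
  gcongr

/-! ### Consequences of non-degeneracy. -/

lemma IsNonDegenerate.le_card {r n : ℕ} {δ : ℝ} (hδ : 0 < δ) {M : Matrix (Fin r) (Fin n) ℝ}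
    (hM : IsNonDegenerate δ M) {V : Fin r → ℝ} (hV : V ≠ 0) :
    δ * n ≤ ((Finset.univ.filter fun j =>
      δ ^ 2 * ∑ k, V k ^ 2 ≤ (∑ k, V k * M k j) ^ 2).card : ℝ) := by
  set v : EuclideanSpace ℝ (Fin r) := WithLp.toLp 2 V with hv
  have hv0 : v ≠ 0 := by
    intro h
    apply hV
    ext k
    have := congrArg (fun u : EuclideanSpace ℝ (Fin r) => u k) h
    simpa [hv] using this
  have hnpos : 0 < ‖v‖ := norm_pos_iff.2 hv0
  have hnsq : ‖v‖ ^ 2 = ∑ k, V k ^ 2 := by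
    rw [EuclideanSpace.norm_sq_eq]
    simp [hv]
  have h := hM (‖v‖⁻¹ • v) (by rw [norm_smul, norm_inv, norm_norm, inv_mul_cancel₀ hnpos.ne'])
  refine h.trans ?_
  norm_cast
  apply Finset.card_le_card
  intro j hj
  simp only [Finset.mem_filter, Finset.mem_univ, true_and] at hj ⊢
  have hin : inner ℝ (WithLp.toLp 2 (M.col j)) (‖v‖⁻¹ • v) = ‖v‖⁻¹ * ∑ k, V k * M k j := by
    rw [inner_smul_right]
    congr 1
  rw [hin, abs_mul, abs_of_pos (inv_pos.2 hnpos), inv_mul_eq_div, le_div_iff₀ hnpos] at hj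
  rw [← hnsq, ← mul_pow, ← sq_abs (∑ k, V k * M k j)]
  gcongr

/-- A vanishing combination of rows would be orthogonal to every column. Independence later yields
injective tuples and r ≤ n. -/
lemma IsNonDegenerate.linearIndependent {r n : ℕ} {δ : ℝ} (hδ : 0 < δ) (hn : 1 ≤ n)
    {M : Matrix (Fin r) (Fin n) ℝ} (hM : IsNonDegenerate δ M) :
    LinearIndependent ℝ (fun k => M k) := by
  rw [Fintype.linearIndependent_iff]
  intro V hV
  by_contra hne
  push Not at hne
  obtain ⟨k, hk⟩ := hne
  have hV0 : V ≠ 0 := fun h => hk (by rw [h]; rfl)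
  have hcard := hM.le_card hδ hV0
  have hpos : (0 : ℝ) < δ * n := by
    have : (1 : ℝ) ≤ n := by exact_mod_cast hn
    positivity
  have hc : 0 < (Finset.univ.filter fun j =>
      δ ^ 2 * ∑ k, V k ^ 2 ≤ (∑ k, V k * M k j) ^ 2).card := by
    exact_mod_cast hpos.trans_le hcard
  obtain ⟨j, hj⟩ := Finset.card_pos.1 hc
  simp only [Finset.mem_filter, Finset.mem_univ, true_and] at hj
  have hz : ∑ k, V k * M k j = 0 := by
    have := congrFun hV j
    simpa using this
  have hs : 0 < ∑ k, V k ^ 2 :=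
    Finset.sum_pos' (fun _ _ => by positivity) ⟨k, Finset.mem_univ k, by positivity⟩
  rw [hz] at hj
  have : 0 < δ ^ 2 * ∑ k, V k ^ 2 := by positivity
  nlinarith

/-- Removing at most δn/2 columns costs at most half of the good ones. -/
lemma IsNonDegenerate.le_card_subtype {r n : ℕ} {δ : ℝ} (hδ : 0 < δ)
    {M : Matrix (Fin r) (Fin n) ℝ} (hM : IsNonDegenerate δ M) (p : Fin n → Prop) [DecidablePred p]
    (hp : (Fintype.card {i // p i} : ℝ) ≤ δ * n / 2) {V : Fin r → ℝ} (hV : V ≠ 0) :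
    δ * n / 2 ≤ ((Finset.univ.filter fun j : {j // ¬p j} =>
      δ ^ 2 * ∑ k, V k ^ 2 ≤ (∑ k, V k * M k j) ^ 2).card : ℝ) := by
  have h1 := hM.le_card hδ hV
  have h2 : ((Finset.univ.filter fun j =>
      δ ^ 2 * ∑ k, V k ^ 2 ≤ (∑ k, V k * M k j) ^ 2).card : ℝ)
      ≤ (Finset.univ.filter fun j : {j // ¬p j} =>
        δ ^ 2 * ∑ k, V k ^ 2 ≤ (∑ k, V k * M k j) ^ 2).card + Fintype.card {i // p i} := by
    rw [Fintype.card_subtype, ← Finset.card_map (Function.Embedding.subtype fun j => ¬p j)]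
    norm_cast
    refine (Finset.card_le_card ?_).trans (Finset.card_union_le _ _)
    intro j hj
    by_cases hpj : p j
    · simp [hpj]
    · simp only [Finset.mem_filter, Finset.mem_univ, true_and] at hj
      simp [hpj, hj]
  linarith

/-! ### Pointwise bound for the characteristic function. -/

lemma abs_coeffMatrix_le {n : ℕ} {a : Fin n → Fin n → ℝ} (ha : ∀ i j, i ≤ j → |a i j| ≤ 1)
    (i j : Fin n) : |coeffMatrix a i j| ≤ 1 := by
  simp only [coeffMatrix, Matrix.of_apply]
  split_ifs with h
  · exact ha i j h
  · exact ha j i (le_of_not_ge h)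

/-- Pointwise bound for the characteristic function of a quadratic polynomial of random signs. -/
lemma exists_norm_sq_sum_cexp_le (r : ℕ) (hr : 1 ≤ r) (δ : ℝ) (hδ : 0 < δ) :
    ∃ C : ℝ, 0 < C ∧ ∀ n : ℕ, 4 * r ≤ δ * n →
      ∀ (a : Fin n → Fin n → ℝ) (b : Fin n → ℝ) (c : ℝ), (∀ i j, i ≤ j → |a i j| ≤ 1) →
      ∀ T : Finset (Fin r → Fin n), δ * n ≤ (T.card : ℝ) →
      (T : Set (Fin r → Fin n)).PairwiseDisjoint (fun t => Set.range t) →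
      (∀ t ∈ T, IsNonDegenerate δ ((coeffMatrix a).submatrix t id)) →
      ∀ τ : ℝ, 0 < τ → 2 * r * τ ≤ 1 →
      ‖∑ ε : Fin n → Bool, Complex.exp
        ((τ * quadraticPoly a b c (fun i => boolSign (ε i)) : ℝ) * Complex.I)‖ ^ 2
      ≤ (2 ^ n) ^ 2 * (C * (1 / (n * τ) + τ)) ^ r := by
  classical
  have hr0 : (0 : ℝ) < r := by exact_mod_cast hr
  have hr1 : (1 : ℝ) ≤ r := by exact_mod_cast hr
  set c₁ : ℝ := √(4 * r / δ) with hc₁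
  set c₂ : ℝ := 2 / (√(δ / 2) * δ) with hc₂
  have hc₁0 : 0 < c₁ := by positivity
  have hc₂0 : 0 < c₂ := by positivity
  refine ⟨16 * (c₁ + 4 * r) * (1 + c₂), by positivity, ?_⟩
  intro n hn a b c ha T hT hdisj hnd τ hτ hrτ
  have hn0 : (0 : ℝ) < n := by
    by_contra hneg
    have : (n : ℝ) = 0 := le_antisymm (not_lt.1 hneg) (Nat.cast_nonneg n)
    rw [this] at hn
    linarith
  have hn1 : 1 ≤ n := by exact_mod_cast hn0
  -- With h ≤ X, the 2h tuples occupy at most 2hr ≤ δn/2 indices.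
  set X : ℝ := δ * n / (4 * r) with hX
  have hX1 : 1 ≤ X := by rw [hX, le_div_iff₀ (by positivity)]; linarith
  set h : ℕ := ⌊X⌋₊ with hh
  have hh0 : 0 < h := Nat.floor_pos.2 hX1
  have hhX : (h : ℝ) ≤ X := Nat.floor_le (by linarith)
  have hXh : X < h + 1 := Nat.lt_floor_add_one X
  have hXr : X * (4 * r) = δ * n := by rw [hX]; field_simp
  have h2h : 2 * h ≤ T.card := by
    have : (2 * h : ℝ) ≤ T.card := by nlinarith
    exact_mod_cast this
  obtain ⟨T', hT'T, hT'⟩ := Finset.exists_subset_card_eq h2h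
  set p : Fin n → Prop := fun i => ∃ t ∈ T', ∃ k, t k = i with hp
  have hpcard : (Fintype.card {i // p i} : ℝ) ≤ δ * n / 2 := by
    have h1 : Fintype.card {i // p i} ≤ 2 * h * r := by
      rw [Fintype.card_subtype, ← hT']
      calc _ ≤ (T'.biUnion fun t => Finset.univ.image t).card := by
            apply Finset.card_le_card
            intro i hi
            simpa [hp] using hi
        _ ≤ T'.card * r := by
            apply Finset.card_biUnion_le_card_mul
            intro t _
            exact Finset.card_image_le.trans (by simp)
    have h2 : (Fintype.card {i // p i} : ℝ) ≤ 2 * h * r := by exact_mod_cast h1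
    nlinarith
  -- ℓ is the largest integer allowed by the condition 2τrℓ ≤ 1 of the box estimate.
  set y : ℝ := 1 / (2 * r * τ) with hy
  have hy1 : 1 ≤ y := by rw [hy, le_div_iff₀ (by positivity)]; linarith
  set ℓ : ℕ := ⌊y⌋₊ with hℓ
  have hℓ0 : 0 < ℓ := Nat.floor_pos.2 hy1
  have hℓy : (ℓ : ℝ) ≤ y := Nat.floor_le (by linarith)
  have hyℓ : y < ℓ + 1 := Nat.lt_floor_add_one y
  have hℓ1 : (1 : ℝ) ≤ ℓ := by exact_mod_cast hℓ0
  have hyr : y * (2 * r * τ) = 1 := by rw [hy]; field_simp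
  have hκ : 0 < δ * n / 2 := by positivity
  refine (norm_sq_sum_cexp_quadraticPoly_le_of_tuples hh0 a b c τ _ T' hT'
    (hdisj.subset (by exact_mod_cast hT'T)) ?_ p (fun _ => Iff.rfl)
    (fun t ht => sum_binomWeight_prod_cos_sq_le h hℓ0 hτ hδ hκ ?_
      (fun k (j : {j // ¬p j}) => coeffMatrix a (t k) j) (fun k j => abs_coeffMatrix_le ha _ _)
      (fun V hV => (hnd t (hT'T ht)).le_card_subtype hδ p hpcard hV))).trans ?_
  -- A repeated index within a tuple would give two equal rows.
  · intro t ht k k' hkk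
    apply ((hnd t (hT'T ht)).linearIndependent hδ hn1).injective
    ext j
    simp [hkk]
  · rw [Fintype.card_fin]
    have : (ℓ : ℝ) * (2 * r * τ) ≤ y * (2 * r * τ) := by gcongr
    linarith
  rw [Fintype.card_fin]
  refine mul_le_mul_of_nonneg_left (pow_le_pow_left₀ (by positivity) ?_ r) (by positivity)
  set N : ℝ := √n with hN
  have hN0 : 0 < N := Real.sqrt_pos.2 hn0
  have hN2 : N ^ 2 = n := Real.sq_sqrt hn0.le
  have e1 : 1 / √(2 * h + 1) ≤ c₁ * (1 / N) := by
    have h1 : c₁ * (1 / N) = √(4 * r / (δ * n)) := by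
      rw [hc₁, hN, ← div_eq_mul_one_div, ← Real.sqrt_div (by positivity), div_div]
    have h2 : 1 / √(2 * (h : ℝ) + 1) = √(1 / (2 * h + 1)) := by
      rw [Real.sqrt_div zero_le_one, Real.sqrt_one]
    rw [h1, h2]
    apply Real.sqrt_le_sqrt
    rw [div_le_div_iff₀ (by positivity) (by positivity)]
    have : (0 : ℝ) ≤ h := Nat.cast_nonneg h
    nlinarith
  have e2 : (1 : ℝ) / ℓ ≤ 4 * r * τ := by
    rw [div_le_iff₀ (by positivity)]
    have h2 : y ≤ 2 * ℓ := by linarith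
    have h3 : y * (2 * r * τ) ≤ 2 * ℓ * (2 * r * τ) := by gcongr
    linarith
  have e3 : 2 / (√(δ * n / 2) * δ * τ) = c₂ * (1 / (N * τ)) := by
    have : δ * n / 2 = δ / 2 * n := by ring
    rw [this, Real.sqrt_mul (by positivity), hc₂, ← hN]
    field_simp
  rw [e3]
  have f1 : 1 / √(2 * h + 1) + 1 / (ℓ : ℝ) ≤ (c₁ + 4 * r) * (1 / N + τ) := by
    have : 0 ≤ c₁ * τ + 4 * r * (1 / N) := by positivity
    linarith
  have f2 : 1 + c₂ * (1 / (N * τ)) ≤ (1 + c₂) * (1 + 1 / (N * τ)) := by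
    have : 0 ≤ c₂ + 1 / (N * τ) := by positivity
    linarith
  have f3 : (1 / N + τ) * (1 + 1 / (N * τ)) ≤ 2 * (1 / (n * τ) + τ) := by
    have h1 : (1 / N + τ) * (1 + 1 / (N * τ)) = (1 / N + τ) ^ 2 / τ := by
      field_simp
      ring
    have h2 : 2 * (1 / (n * τ) + τ) = 2 * ((1 / N) ^ 2 + τ ^ 2) / τ := by
      rw [← hN2]; field_simp
    rw [h1, h2]
    gcongr
    nlinarith [sq_nonneg (1 / N - τ)]
  calc 2 * (1 / √(2 * h + 1) + 1 / (ℓ : ℝ)) * (4 * (1 + c₂ * (1 / (N * τ))))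
      ≤ 2 * ((c₁ + 4 * r) * (1 / N + τ)) * (4 * ((1 + c₂) * (1 + 1 / (N * τ)))) := by gcongr
    _ = 8 * (c₁ + 4 * r) * (1 + c₂) * ((1 / N + τ) * (1 + 1 / (N * τ))) := by ring
    _ ≤ 8 * (c₁ + 4 * r) * (1 + c₂) * (2 * (1 / (n * τ) + τ)) := by gcongr
    _ = _ := by ring

/-! ### Integration over the frequencies. -/

lemma integral_one_add_mul_rpow_le {R : ℝ} (hR : 0 < R) :
    ∫ w in (0 : ℝ)..1, (1 + w * R) ^ (-(3 / 2) : ℝ) ≤ 2 / R := by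
  have hpos : ∀ w ∈ Set.uIcc (0 : ℝ) 1, 0 < 1 + w * R := by
    intro w hw
    rw [Set.uIcc_of_le zero_le_one] at hw
    have := mul_nonneg hw.1 hR.le
    linarith
  have hd : ∀ w ∈ Set.uIcc (0 : ℝ) 1, HasDerivAt
      (fun w : ℝ => -(2 / R) * (1 + w * R) ^ (-(1 / 2) : ℝ)) ((1 + w * R) ^ (-(3 / 2) : ℝ)) w := by
    intro w hw
    have h1 : HasDerivAt (fun w : ℝ => 1 + w * R) R w := by
      simpa using ((hasDerivAt_id w).mul_const R).const_add 1
    have h2 := (h1.rpow_const (p := -(1 / 2)) (Or.inl (hpos w hw).ne')).const_mul (-(2 / R))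
    refine h2.congr_deriv ?_
    have : (-(1 / 2) - 1 : ℝ) = -(3 / 2) := by norm_num
    rw [this]
    field_simp
  have hint : IntervalIntegrable (fun w : ℝ => (1 + w * R) ^ (-(3 / 2) : ℝ)) volume 0 1 := by
    apply ContinuousOn.intervalIntegrable
    exact ContinuousOn.rpow_const (by fun_prop) fun w hw => Or.inl (hpos w hw).ne'
  rw [intervalIntegral.integral_eq_sub_of_hasDerivAt hd hint]
  have h1 : 0 ≤ 2 / R * (1 + 1 * R) ^ (-(1 / 2) : ℝ) := by positivity
  simp only [zero_mul, add_zero, Real.one_rpow, mul_one]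
  linarith

lemma add_pow_le_two_pow_mul {x y : ℝ} (hx : 0 ≤ x) (hy : 0 ≤ y) (r : ℕ) :
    (x + y) ^ r ≤ 2 ^ r * (x ^ r + y ^ r) := by
  have h1 : x + y ≤ 2 * max x y := by linarith [le_max_left x y, le_max_right x y]
  calc (x + y) ^ r ≤ (2 * max x y) ^ r := by gcongr
    _ = 2 ^ r * max x y ^ r := mul_pow _ _ _
    _ ≤ _ := by
      gcongr
      rcases max_choice x y with h | h <;> rw [h]
      · linarith [pow_nonneg hy r]
      · linarith [pow_nonneg hx r]

/-- For wR < 1 the trivial bound φ ≤ 1 suffices. For wR ≥ 1, (1/(wR))^r ≤ (1/(wR))³ because r ≥ 3,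
and (w/s)^r ≤ 1/R²; square roots give the two terms. -/
lemma le_of_sq_le_characteristic_bound {r : ℕ} (hr : 3 ≤ r) {C R s w φ : ℝ} (hC : 0 < C)
    (hR : 0 < R) (hs : 0 < s) (hRs : s ^ r = R ^ 2) (hw : 0 < w) (hw1 : w ≤ 1) (hφ1 : φ ≤ 1)
    (hφ : φ ^ 2 ≤ (C * (1 / (w * R) + w / s)) ^ r) :
    φ ≤ (3 + √(8 * (2 * C) ^ r)) * (1 / R + (1 + w * R) ^ (-(3 / 2) : ℝ)) := by
  set x := w * R with hx
  have hx0 : 0 < x := by positivity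
  set u : ℝ := (1 + x) ^ (-(3 / 2) : ℝ) with hu
  have hu0 : 0 < u := by positivity
  have hu2 : u ^ 2 = 1 / (1 + x) ^ 3 := by
    rw [hu, ← Real.rpow_natCast, ← Real.rpow_mul (by positivity)]
    have : (-(3 / 2) * ((2 : ℕ) : ℝ)) = -((3 : ℕ) : ℝ) := by norm_num
    rw [this, Real.rpow_neg (by positivity), Real.rpow_natCast, one_div]
  have hR' : 0 < 1 / R := by positivity
  rcases lt_or_ge x 1 with hx1 | hx1
  · have h1 : 1 ≤ 3 * u := by
      have h2 : 1 ≤ (3 * u) ^ 2 := by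
        rw [mul_pow, hu2, mul_one_div, le_div_iff₀ (by positivity)]
        have : (1 + x) ^ 3 ≤ 2 ^ 3 := by gcongr; linarith
        linarith
      nlinarith
    have h3 : 0 ≤ √(8 * (2 * C) ^ r) * (1 / R + u) := by positivity
    nlinarith
  · have h1 : (C * (1 / x + w / s)) ^ r ≤ (2 * C) ^ r * (8 * u ^ 2 + (1 / R) ^ 2) := by
      have h2 := add_pow_le_two_pow_mul (x := 1 / x) (y := w / s) (by positivity) (by positivity) r
      have h3 : (1 / x) ^ r ≤ 8 * u ^ 2 := by
        calc (1 / x) ^ r ≤ (1 / x) ^ 3 :=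
              pow_le_pow_of_le_one (by positivity) ((div_le_one hx0).2 hx1) hr
          _ ≤ 8 * u ^ 2 := by
            rw [hu2, div_pow, one_pow, mul_one_div, div_le_div_iff₀ (by positivity) (by positivity)]
            have : (1 + x) ^ 3 ≤ (2 * x) ^ 3 := by gcongr; linarith
            rw [mul_pow] at this
            linarith
      have h4 : (w / s) ^ r ≤ (1 / R) ^ 2 := by
        rw [div_pow, hRs, div_pow, one_pow]
        gcongr
        exact pow_le_one₀ hw.le hw1
      rw [mul_pow, mul_pow, mul_comm (2 ^ r : ℝ), mul_assoc]
      gcongr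
      refine h2.trans ?_
      gcongr
    have h5 : φ ^ 2 ≤ (√(8 * (2 * C) ^ r) * (1 / R + u)) ^ 2 := by
      rw [mul_pow, Real.sq_sqrt (by positivity)]
      have h6 : 8 * u ^ 2 + (1 / R) ^ 2 ≤ 8 * (1 / R + u) ^ 2 := by
        have : 0 ≤ 1 / R * u := by positivity
        nlinarith
      calc _ ≤ (2 * C) ^ r * (8 * u ^ 2 + (1 / R) ^ 2) := hφ.trans h1
        _ ≤ (2 * C) ^ r * (8 * (1 / R + u) ^ 2) := by gcongr
        _ = _ := by ring
    have h7 := le_of_sq_le_sq h5 (by positivity)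
    have h8 : 0 ≤ 3 * (1 / R + u) := by positivity
    linarith

/-! ### From probabilities to proportions of sign vectors. -/

lemma rademacher_singleton_boolSign (b : Bool) :
    rademacher {boolSign b} = (1 / 2 : ℝ≥0∞) := by
  have h1 : (1 : ℝ) ≠ -1 := by norm_num
  cases b <;> simp [rademacher, boolSign, h1, h1.symm]

lemma rademacher_compl : rademacher {x | x ≠ 1 ∧ x ≠ -1} = 0 := by
  have hm : MeasurableSet {x : ℝ | x ≠ 1 ∧ x ≠ -1} := by measurability
  simp [rademacher, hm]

/-- The probability of an event about a Rademacher vector is at most the proportion of sign vectors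
that satisfy it. -/
lemma IsRademacherVector.measureReal_le {Ω : Type*} [MeasurableSpace Ω] {μ : Measure Ω}
    [IsProbabilityMeasure μ] {n : ℕ} {ξ : Fin n → Ω → ℝ} (hξ : IsRademacherVector ξ μ)
    (P : (Fin n → ℝ) → Prop) [DecidablePred fun ε : Fin n → Bool => P fun i => boolSign (ε i)] :
    μ.real {ω | P fun i => ξ i ω}
      ≤ ((Finset.univ.filter fun ε : Fin n → Bool => P fun i => boolSign (ε i)).card : ℝ)
        / 2 ^ n := by
  set S := Finset.univ.filter fun ε : Fin n → Bool => P fun i => boolSign (ε i) with hS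
  set Z : Set Ω := ⋃ i, {ω | ξ i ω ≠ 1 ∧ ξ i ω ≠ -1} with hZ
  have hZ0 : μ Z = 0 := by
    rw [hZ, measure_iUnion_null_iff]
    intro i
    rw [(hξ.hasLaw i).measure_eq (p := fun x => x ≠ 1 ∧ x ≠ -1) (by measurability)]
    exact rademacher_compl
  have hpt : ∀ ε : Fin n → Bool, μ (⋂ i, ξ i ⁻¹' {boolSign (ε i)}) = (1 / 2 : ℝ≥0∞) ^ n := by
    intro ε
    rw [hξ.indep.meas_iInter fun i => ⟨_, measurableSet_singleton _, rfl⟩]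
    have : ∀ i, μ (ξ i ⁻¹' {boolSign (ε i)}) = (1 / 2 : ℝ≥0∞) := by
      intro i
      rw [← rademacher_singleton_boolSign (ε i)]
      exact (hξ.hasLaw i).measure_eq (p := fun x => x ∈ ({boolSign (ε i)} : Set ℝ))
        (measurableSet_singleton _)
    simp [this]
  have hsub : {ω | P fun i => ξ i ω} ⊆ Z ∪ ⋃ ε ∈ S, ⋂ i, ξ i ⁻¹' {boolSign (ε i)} := by
    intro ω hω
    by_cases hz : ω ∈ Z
    · exact Or.inl hz
    right
    simp only [hZ, Set.mem_iUnion, Set.mem_ofPred_eq, not_exists, not_and_or, not_not] at hz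
    have hval : ∀ i, ξ i ω = boolSign (decide (ξ i ω = 1)) := by
      intro i
      by_cases h1 : ξ i ω = 1
      · simp [boolSign, h1]
      · simpa [boolSign, h1] using hz i
    simp only [Set.mem_iUnion, Set.mem_iInter, Set.mem_preimage, Set.mem_singleton_iff]
    refine ⟨fun i => decide (ξ i ω = 1), ?_, hval⟩
    rw [hS, Finset.mem_filter]
    refine ⟨Finset.mem_univ _, ?_⟩
    have : (fun i => boolSign (decide (ξ i ω = 1))) = fun i => ξ i ω :=
      funext fun i => (hval i).symm
    rw [this]
    exact hω
  have hle : μ {ω | P fun i => ξ i ω} ≤ S.card * (1 / 2 : ℝ≥0∞) ^ n := by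
    refine (measure_mono hsub).trans ((measure_union_le _ _).trans ?_)
    rw [hZ0, zero_add]
    refine (measure_biUnion_finset_le _ _).trans_eq ?_
    simp [hpt]
  have htop : (S.card : ℝ≥0∞) * (1 / 2 : ℝ≥0∞) ^ n ≠ ⊤ := by finiteness
  refine (ENNReal.toReal_mono htop hle).trans_eq ?_
  simp [div_eq_mul_inv]

/-! ### Conclusion. -/

lemma exists_proportion_quadraticPoly_near_le (r : ℕ) (hr : 3 ≤ r) (δ : ℝ) (hδ : 0 < δ) :
    ∃ C : ℝ, 0 < C ∧ ∀ n : ℕ, 4 * r ≤ δ * n → 2 * (r : ℝ) ≤ (n : ℝ) ^ (2 / ((r : ℝ) + 2)) →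
      ∀ (a : Fin n → Fin n → ℝ) (b : Fin n → ℝ) (c : ℝ), (∀ i j, i ≤ j → |a i j| ≤ 1) →
      ∀ T : Finset (Fin r → Fin n), δ * n ≤ (T.card : ℝ) →
      (T : Set (Fin r → Fin n)).PairwiseDisjoint (fun t => Set.range t) →
      (∀ t ∈ T, IsNonDegenerate δ ((coeffMatrix a).submatrix t id)) →
      ∀ x : ℝ, ((Finset.univ.filter fun ε : Fin n → Bool =>
          |quadraticPoly a b c (fun i => boolSign (ε i)) - x|
            ≤ (n : ℝ) ^ (2 / ((r : ℝ) + 2))).card : ℝ) / 2 ^ n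
        ≤ C / (n : ℝ) ^ (1 - 2 / ((r : ℝ) + 2)) := by
  obtain ⟨C, hC, H⟩ := exists_norm_sq_sum_cexp_le r (by omega) δ hδ
  have hr0 : (0 : ℝ) < r := by exact_mod_cast (by omega : 0 < r)
  set C' : ℝ := 3 + √(8 * (2 * C) ^ r) with hC'
  have hC'0 : 0 < C' := by positivity
  refine ⟨24 * C', by positivity, ?_⟩
  intro n hn hs2 a b c ha T hT hdisj hnd x
  have hn0 : (0 : ℝ) < n := by
    by_contra hneg
    have : (n : ℝ) = 0 := le_antisymm (not_lt.1 hneg) (Nat.cast_nonneg n)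
    rw [this] at hn
    linarith
  set s : ℝ := (n : ℝ) ^ (2 / ((r : ℝ) + 2)) with hs
  set R : ℝ := (n : ℝ) ^ (1 - 2 / ((r : ℝ) + 2)) with hR
  have hs0 : 0 < s := by positivity
  have hR0 : 0 < R := by positivity
  have hsR : s * R = n := by
    rw [hs, hR, ← Real.rpow_add hn0]; simp
  -- This identity fixes the exponent 2/(r+2): at τ = 1/s the term τ^(r/2) is exactly 1/R.
  have hRs : s ^ r = R ^ 2 := by
    rw [hs, hR, ← Real.rpow_natCast, ← Real.rpow_natCast, ← Real.rpow_mul hn0.le,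
      ← Real.rpow_mul hn0.le]
    congr 1
    push_cast
    field_simp
    ring
  set X : (Fin n → Bool) → ℝ := fun ε => quadraticPoly a b c (fun i => boolSign (ε i)) with hX
  set Φ : ℝ → ℝ := fun w => ‖∑ ε, Complex.exp ((w / s * X ε : ℝ) * Complex.I)‖ with hΦ
  have hcard := card_abs_sub_le_le_integral X x hs0
  have hΦle : ∀ w ∈ Set.Ioo (0 : ℝ) 1,
      Φ w ≤ 2 ^ n * (C' * (1 / R + (1 + w * R) ^ (-(3 / 2) : ℝ))) := by
    intro w hw
    have h1 : Φ w / 2 ^ n ≤ 1 := by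
      rw [div_le_one (by positivity)]
      refine (norm_sum_le _ _).trans_eq ?_
      simp only [Complex.norm_exp_ofReal_mul_I]
      simp
    have h2 : (Φ w / 2 ^ n) ^ 2 ≤ (C * (1 / (w * R) + w / s)) ^ r := by
      rw [div_pow, div_le_iff₀ (by positivity), mul_comm]
      have h3 := H n hn a b c ha T hT hdisj hnd (w / s) (div_pos hw.1 hs0) (by
        rw [mul_div_assoc', div_le_one hs0]
        have : 2 * (r : ℝ) * w ≤ 2 * r * 1 := by gcongr; exact hw.2.le
        linarith)
      have h4 : (n : ℝ) * (w / s) = w * R := by rw [← hsR]; field_simp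
      rw [h4] at h3
      exact h3
    have h5 := le_of_sq_le_characteristic_bound hr hC hR0 hs0 hRs hw.1 hw.2.le h1 h2
    rwa [div_le_iff₀' (by positivity)] at h5
  have hcont : Continuous Φ := by fun_prop
  have hi1 : IntervalIntegrable (fun w : ℝ => (1 + w * R) ^ (-(3 / 2) : ℝ)) volume 0 1 := by
    apply ContinuousOn.intervalIntegrable
    refine ContinuousOn.rpow_const (by fun_prop) fun w hw => Or.inl ?_
    rw [Set.uIcc_of_le zero_le_one] at hw
    have := mul_nonneg hw.1 hR0.le
    linarith
  have hint : ∫ w in (0 : ℝ)..1, Φ w ≤ 2 ^ n * (C' * (3 / R)) := by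
    calc ∫ w in (0 : ℝ)..1, Φ w
        ≤ ∫ w in (0 : ℝ)..1, 2 ^ n * (C' * (1 / R + (1 + w * R) ^ (-(3 / 2) : ℝ))) := by
          apply intervalIntegral.integral_mono_on_of_le_Ioo zero_le_one
            (hcont.intervalIntegrable _ _)
          · exact ((intervalIntegrable_const.add hi1).const_mul _).const_mul _
          · exact hΦle
      _ = 2 ^ n * (C' * (1 / R + ∫ w in (0 : ℝ)..1, (1 + w * R) ^ (-(3 / 2) : ℝ))) := by
          rw [intervalIntegral.integral_const_mul, intervalIntegral.integral_const_mul,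
            intervalIntegral.integral_add intervalIntegrable_const hi1]
          simp
      _ ≤ 2 ^ n * (C' * (1 / R + 2 / R)) := by
          gcongr
          exact integral_one_add_mul_rpow_le hR0
      _ = _ := by ring
  rw [div_le_iff₀ (by positivity)]
  calc _ ≤ 8 * ∫ w in (0 : ℝ)..1, Φ w := hcard
    _ ≤ 8 * (2 ^ n * (C' * (3 / R))) := by gcongr
    _ = _ := by ring

theorem lemma3p2 (r : ℕ) (hr : 3 ≤ r) (δ : ℝ) (hδ : 0 < δ) :
    ∃ C : ℝ, 0 < C ∧
      ∀ (n : ℕ), 1 ≤ n →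
      ∀ (a : Fin n → Fin n → ℝ) (b : Fin n → ℝ) (c : ℝ),
      (∀ i j, i ≤ j → |a i j| ≤ 1) →
      ∀ T : Finset (Fin r → Fin n),
      δ * n ≤ (T.card : ℝ) →
      (T : Set (Fin r → Fin n)).PairwiseDisjoint (fun t => Set.range t) →
      (∀ t ∈ T, IsNonDegenerate δ ((coeffMatrix a).submatrix t id)) →
      ∀ (Ω : Type*) [MeasurableSpace Ω] (μ : Measure Ω) [IsProbabilityMeasure μ]
        (ξ : Fin n → Ω → ℝ), IsRademacherVector ξ μ →
      ∀ x : ℝ,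
      μ.real {ω | |quadraticPoly a b c (fun i => ξ i ω) - x| ≤ (n : ℝ) ^ (2 / ((r : ℝ) + 2))}
        ≤ C * (Real.log n ^ ((r : ℝ) / 2) / (n : ℝ) ^ (1 - 2 / ((r : ℝ) + 2))) := by
  obtain ⟨C, hC, H⟩ := exists_proportion_quadraticPoly_near_le r hr δ hδ
  have hr0 : (0 : ℝ) < r := by exact_mod_cast (by omega : 0 < r)
  have hr1 : (1 : ℝ) ≤ r := by exact_mod_cast (by omega : 1 ≤ r)
  -- Beyond N both size conditions of the previous lemma hold: 4r ≤ δn and 2r ≤ n^(2/(r+2)).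
  set N : ℝ := 4 * r / δ + (2 * r) ^ (((r : ℝ) + 2) / 2) with hN
  have hN0 : 0 < N := by positivity
  refine ⟨C + N, by positivity, ?_⟩
  intro n hn a b c ha T hT hdisj hnd Ω _ μ _ ξ hξ x
  have hn1 : (1 : ℝ) ≤ n := by exact_mod_cast hn
  have hn0 : (0 : ℝ) < n := by linarith
  have hT0 : T.Nonempty := by
    rw [← Finset.card_pos]
    have : (0 : ℝ) < T.card := (by positivity : 0 < δ * n).trans_le hT
    exact_mod_cast this
  obtain ⟨t, ht⟩ := hT0
  have hrn : r ≤ n := by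
    simpa using ((hnd t ht).linearIndependent hδ hn).fintype_card_le_finrank
  -- Here n ≥ r ≥ 3 > e.
  have hlog : 1 ≤ Real.log n ^ ((r : ℝ) / 2) := by
    apply Real.one_le_rpow _ (by positivity)
    rw [Real.le_log_iff_exp_le hn0]
    have h3 : (3 : ℝ) ≤ n := by exact_mod_cast hr.trans hrn
    linarith [Real.exp_one_lt_d9]
  have hexp : 2 / ((r : ℝ) + 2) ≤ 1 := by
    rw [div_le_one (by positivity)]; linarith
  set R : ℝ := (n : ℝ) ^ (1 - 2 / ((r : ℝ) + 2)) with hR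
  have hR0 : 0 < R := by positivity
  have key : μ.real {ω | |quadraticPoly a b c (fun i => ξ i ω) - x|
      ≤ (n : ℝ) ^ (2 / ((r : ℝ) + 2))} ≤ (C + N) / R := by
    rcases le_or_gt N n with hNn | hNn
    · have h1 : 4 * r ≤ δ * n := by
        have : 4 * r / δ ≤ n := le_trans (by rw [hN]; linarith [(by positivity :
          0 ≤ (2 * (r : ℝ)) ^ (((r : ℝ) + 2) / 2))]) hNn
        rwa [div_le_iff₀' hδ] at this
      have h2 : 2 * (r : ℝ) ≤ (n : ℝ) ^ (2 / ((r : ℝ) + 2)) := by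
        have h3 : (2 * (r : ℝ)) ^ (((r : ℝ) + 2) / 2) ≤ n := le_trans (by
          rw [hN]; linarith [(by positivity : 0 ≤ 4 * r / δ)]) hNn
        calc 2 * (r : ℝ) = ((2 * (r : ℝ)) ^ (((r : ℝ) + 2) / 2)) ^ (2 / ((r : ℝ) + 2)) := by
              rw [← Real.rpow_mul (by positivity)]
              have : ((r : ℝ) + 2) / 2 * (2 / ((r : ℝ) + 2)) = 1 := by field_simp
              rw [this, Real.rpow_one]
          _ ≤ _ := Real.rpow_le_rpow (by positivity) h3 (by positivity)
      refine (hξ.measureReal_le fun v => |quadraticPoly a b c v - x|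
        ≤ (n : ℝ) ^ (2 / ((r : ℝ) + 2))).trans ((H n h1 h2 a b c ha T hT hdisj hnd x).trans ?_)
      gcongr
      linarith
    -- For n < N the bound is trivial, since R ≤ n.
    · refine measureReal_le_one.trans ?_
      rw [le_div_iff₀ hR0, one_mul]
      calc R ≤ (n : ℝ) ^ (1 : ℝ) := by
            apply Real.rpow_le_rpow_of_exponent_le hn1
            linarith [(by positivity : 0 ≤ 2 / ((r : ℝ) + 2))]
        _ ≤ C + N := by rw [Real.rpow_one]; linarith
  calc _ ≤ (C + N) * (1 / R) := by rw [mul_one_div]; exact key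
    _ ≤ _ := by gcongr
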